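/- Let $f:\mathbb R^n\to\mathbb R^n$ have polynomial components, and let $M(x)$ be an $n\times n$ matrix with entries in $\mathbb R[x]=\mathbb R[x_1,\dots,x_n]$. A symmetric matrix $S(x)\in\mathbb R[x]^{m\times m}$ is an SOS matrix if the polynomial $y^TS(x)y$ is a sum of squares in $\mathbb R[x,y]$, $y=(y_1,\dots,y_m)$; it is strictly SOS if $S(x)-\epsilon I$ is an SOS matrix for some $\epsilon>0$. Put $\dot M=\sum_k \frac{\partial M}{\partial x_k}f_k$ and $$R(x)=\Big(\frac{\partial f}{\partial x}\Big)^TM+M\frac{\partial f}{\partial x}+\dot M .$$ Suppose that $M(x)$ and $-R(x)$ are strictly SOS. Let $d_M(p,q)$ be the infimum of $\int_0^1\sqrt{\gamma'(s)^TM(\gamma(s))\gamma'(s)}\,ds$ over all $C^1$ paths $\gamma$ from $p$ to $q$. Then the system $\dot x=f(x)$ is globally contracting, in the following sense. 1. The whole state space is a contraction region with respect to $M$: there is $\epsilon>0$ with $M(x)\succeq\epsilon I$ and $R(x)\preceq-\epsilon I$ for all $x\in\mathbb R^n$. 2. For every $p\in\mathbb R^n$ there is exactly one solution on $[0,\infty)$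 with $x(0)=p$. 3. For any two solutions $x,y$ on $[0,\infty)$ the function $t\mapsto d_M(x(t),y(t))$ is nonincreasing; so a trajectory that starts in a ball of constant radius (with respect to $d_M$) around another trajectory remains in it. 4. If $\beta>0$ and $R(x)\preceq-\beta M(x)$ for all $x$, then $d_M(x(t),y(t))\le e^{-\beta t/2}d_M(x(0),y(0))$ for any two solutions $x,y$ and all $t\ge0$. 5. Trajectories converge exponentially to one another, provided that the system has at least one solution that is bounded on $[0,\infty)$ (for example an equilibrium): in that case $f$ has exactly one zero, and there is $\lambda>0$ such that for every $r$ there is a constant $C$ with $$\|x(t)-y(t)\|\le C e^{-\lambda t}\|x(0)-y(0)\|\qquad(t\ge0)$$ for all solutions $x,y$ on $[0,\infty)$ with $\|x(0)\|\le r$ and $\|y(0)\|\le r$. -/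

import Mathlib

noncomputable section

/-- The state space `ℝⁿ` with its Euclidean norm. -/
abbrev StateSpace (n : ℕ) : Type := EuclideanSpace ℝ (Fin n)

/-- A vector field on `ℝⁿ` with polynomial components. -/
abbrev PolyField (n : ℕ) : Type := Fin n → MvPolynomial (Fin n) ℝ

/-- A square matrix of size `m` with entries in `ℝ[x₁, …, xₙ]`. -/
abbrev PolyMatrix (n m : ℕ) : Type := Matrix (Fin m) (Fin m) (MvPolynomial (Fin n) ℝ)

/-- The vector field `x ↦ f(x)` on `ℝⁿ`. -/
def PolyField.toFun {n : ℕ} (f : PolyField n) (x : StateSpace n) : StateSpace n :=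
  WithLp.toLp 2 fun i => MvPolynomial.eval (fun k => x k) (f i)

/-- The real matrix `S(x)`. -/
def PolyMatrix.at {n m : ℕ} (S : PolyMatrix n m) (x : StateSpace n) : Matrix (Fin m) (Fin m) ℝ :=
  Matrix.of fun i j => MvPolynomial.eval (fun k => x k) (S i j)

/-- The scalar polynomial `yᵀ S(x) y` in `ℝ[x, y]`; the indeterminates `x` are indexed by the left
summand and the new indeterminates `y` by the right one. -/
def PolyMatrix.quadForm {n m : ℕ} (S : PolyMatrix n m) : MvPolynomial (Fin n ⊕ Fin m) ℝ :=
  ∑ i, ∑ j, MvPolynomial.X (Sum.inr i) * MvPolynomial.rename Sum.inl (S i j) *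
    MvPolynomial.X (Sum.inr j)

/-- A symmetric polynomial matrix is a sum of squares matrix if `yᵀ S(x) y` is a sum of squares
in `ℝ[x, y]`. -/
def PolyMatrix.IsSOS {n m : ℕ} (S : PolyMatrix n m) : Prop :=
  S.IsSymm ∧ IsSumSq S.quadForm

/-- `S` is strictly SOS if `S - ε I` is an SOS matrix for some `ε > 0`. -/
def PolyMatrix.IsStrictlySOS {n m : ℕ} (S : PolyMatrix n m) : Prop :=
  ∃ ε : ℝ, 0 < ε ∧ PolyMatrix.IsSOS (S - Matrix.scalar (Fin m) (MvPolynomial.C ε))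

/-- The Jacobian matrix `∂f/∂x`. -/
def PolyField.jacobian {n : ℕ} (f : PolyField n) : PolyMatrix n n :=
  Matrix.of fun i j => MvPolynomial.pderiv j (f i)

/-- The derivative `Ṁ = ∑ₖ (∂M/∂xₖ) fₖ` of `M(x)` along the system `ẋ = f(x)`. -/
def PolyField.dotMatrix {n : ℕ} (f : PolyField n) (M : PolyMatrix n n) : PolyMatrix n n :=
  Matrix.of fun i j => ∑ k, MvPolynomial.pderiv k (M i j) * f k

/-- `R = (∂f/∂x)ᵀ M + M (∂f/∂x) + Ṁ`. -/
def PolyField.metricVariation {n : ℕ} (f : PolyField n) (M : PolyMatrix n n) : PolyMatrix n n :=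
  f.jacobian.transpose * M + M * f.jacobian + f.dotMatrix M

/-- The region `Ω` is a contraction region of `ẋ = f(x)` with respect to the metric `M`: the
symmetric matrix `M` is uniformly positive definite, and `R` is uniformly negative definite
on `Ω`. -/
def IsContractionRegion {n : ℕ} (f : PolyField n) (M : PolyMatrix n n)
    (Ω : Set (StateSpace n)) : Prop :=
  (∃ ε : ℝ, 0 < ε ∧ ∀ x : StateSpace n, (M.at x - ε • (1 : Matrix (Fin n) (Fin n) ℝ)).PosSemidef) ∧
  ∃ ε : ℝ, 0 < ε ∧ ∀ x ∈ Ω,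
    (-(PolyMatrix.at (f.metricVariation M) x) - ε • (1 : Matrix (Fin n) (Fin n) ℝ)).PosSemidef

/-- `x` solves `ẋ = f(x)` on the time interval `[0, ∞)`. -/
def PolyField.IsSolution {n : ℕ} (f : PolyField n) (x : ℝ → StateSpace n) : Prop :=
  IsIntegralCurveOn x (fun _ => f.toFun) (Set.Ici 0)

/-- The length `∫₀¹ √(γ'(s)ᵀ M(γ(s)) γ'(s)) ds` of a path `γ` with respect to the metric `M`. -/
def PolyMatrix.pathLength {n : ℕ} (M : PolyMatrix n n) (γ : ℝ → StateSpace n) : ℝ :=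
  ∫ s in (0 : ℝ)..1, Real.sqrt
    (dotProduct (deriv γ s).ofLp (Matrix.mulVec (M.at (γ s)) (deriv γ s).ofLp))

/-- The distance of `p` and `q` with respect to the metric `M`: the infimum of the lengths of the
continuously differentiable paths from `p` to `q`. -/
def PolyMatrix.metricDist {n : ℕ} (M : PolyMatrix n n) (p q : StateSpace n) : ℝ :=
  sInf {L : ℝ | ∃ γ : ℝ → StateSpace n,
    ContDiff ℝ 1 γ ∧ γ 0 = p ∧ γ 1 = q ∧ L = M.pathLength γ}

/-- Any two trajectories of `ẋ = f(x)` converge to one another exponentially, with one rate for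
all of them and with an overshoot that is locally uniform in the initial states. -/
def PolyField.ExponentiallyConvergent {n : ℕ} (f : PolyField n) : Prop :=
  ∃ lam : ℝ, 0 < lam ∧ ∀ r : ℝ, ∃ C : ℝ, ∀ x y : ℝ → StateSpace n,
    f.IsSolution x → f.IsSolution y → ‖x 0‖ ≤ r → ‖y 0‖ ≤ r →
      ∀ t : ℝ, 0 ≤ t → ‖x t - y t‖ ≤ C * Real.exp (-(lam * t)) * ‖x 0 - y 0‖

end

/-! Evaluating the SOS certificates at real points gives `M ⪰ εI` and `-R ⪰ δI` everywhere. Put `g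
(x, v) = vᵀ M(x) v`. When a tangent vector `v` is carried along by the flow, the derivative of `g`
is `vᵀ R(x) v`. Only smoothness, homogeneity and coercivity of `g` are needed from there on, so the
analysis is done for squared Finsler norms.

Contraction of distances (`dist_le_exp_mul_dist`) avoids differentiating the flow in its initial
state. A nearly minimal path is pushed forward by the Euler map `z ↦ z + h f(z)`. Its length is
multiplied by at most `e^{-βh/2} + O(h²)`, and its endpoints miss the true trajectories by `O(h²)`.
The triangle inequality gives a one-step estimate with error `O(h²)`, and the errors vanish in the
limit of fine subdivisions of `[0, T]`.

The velocity `f(x(t))` is itself carried by the flow, so `g (x, f x)` does not grow along a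
trajectory. The speed is therefore bounded, which excludes escape in finite time. On a bounded
trajectory the velocity decays exponentially, so every limit point is a zero of `f`.

Since `M` may be unbounded, `R ⪯ -δI` yields a rate relative to `M` only on balls. Given an
equilibrium `p`, metric balls around `p` are forward invariant and bounded in norm. Every trajectory
enters the unit metric ball around `p`, after a time that depends only on the bound on its initial
state; from then on a single rate applies. -/

open Set Filter Topology MeasureTheory

/-! ### Lengths and distances of a squared Finsler norm -/

/-- A twice continuously differentiable squared Finsler norm `g (x, v)` on the tangent vectors `v`
at `x`, uniformly bounded below by `ε ‖v‖ ^ 2`. -/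
structure IsSquaredFinslerNorm {E : Type*} [NormedAddCommGroup E] [NormedSpace ℝ E]
    (g : E × E → ℝ) (ε : ℝ) : Prop where
  eps_pos : 0 < ε
  contDiff : ContDiff ℝ 2 g
  map_smul : ∀ (x : E) (c : ℝ) (v : E), g (x, c • v) = c ^ 2 * g (x, v)
  coercive : ∀ x v : E, ε * ‖v‖ ^ 2 ≤ g (x, v)

/-- The length of a path with respect to a squared Finsler norm. -/
noncomputable def finslerLength {E : Type*} [NormedAddCommGroup E] [NormedSpace ℝ E]
    (g : E × E → ℝ) (γ : ℝ → E) : ℝ :=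
  ∫ s in (0 : ℝ)..1, √(g (γ s, deriv γ s))

/-- The infimum of the lengths of the `C¹` paths from `p` to `q`. -/
noncomputable def finslerDist {E : Type*} [NormedAddCommGroup E] [NormedSpace ℝ E]
    (g : E × E → ℝ) (p q : E) : ℝ :=
  sInf {L : ℝ | ∃ γ : ℝ → E, ContDiff ℝ 1 γ ∧ γ 0 = p ∧ γ 1 = q ∧ L = finslerLength g γ}

/-- Such a point is a global minimum. This also covers `x = 0`, where the function is not locally
constant. -/
theorem hasDerivAt_smoothTransition_of_nonpos {x : ℝ} (hx : x ≤ 0) :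
    HasDerivAt Real.smoothTransition 0 x := by
  have hd : DifferentiableAt ℝ Real.smoothTransition x :=
    (Real.smoothTransition.contDiff (n := 1)).differentiable (by simp) x
  have hmin : IsLocalMin Real.smoothTransition x := Eventually.of_forall fun y => by
    rw [Real.smoothTransition.zero_of_nonpos hx]
    exact Real.smoothTransition.nonneg y
  simpa [hmin.deriv_eq_zero] using hd.hasDerivAt

theorem hasDerivAt_smoothTransition_of_one_le {x : ℝ} (hx : 1 ≤ x) :
    HasDerivAt Real.smoothTransition 0 x := by
  have hd : DifferentiableAt ℝ Real.smoothTransition x :=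
    (Real.smoothTransition.contDiff (n := 1)).differentiable (by simp) x
  have hmax : IsLocalMax Real.smoothTransition x := Eventually.of_forall fun y => by
    rw [Real.smoothTransition.one_of_one_le hx]
    exact Real.smoothTransition.le_one y
  simpa [hmax.deriv_eq_zero] using hd.hasDerivAt

namespace IsSquaredFinslerNorm

variable {E : Type*} [NormedAddCommGroup E] [NormedSpace ℝ E] {g : E × E → ℝ} {ε : ℝ}

theorem nonneg (hg : IsSquaredFinslerNorm g ε) (x v : E) : 0 ≤ g (x, v) :=
  le_trans (by have := hg.eps_pos; positivity) (hg.coercive x v)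

theorem map_zero (hg : IsSquaredFinslerNorm g ε) (x : E) : g (x, 0) = 0 := by
  simpa using hg.map_smul x 0 0

theorem sqrt_mul_norm_le (hg : IsSquaredFinslerNorm g ε) (x v : E) :
    √ε * ‖v‖ ≤ √(g (x, v)) := by
  apply Real.le_sqrt_of_sq_le
  rw [mul_pow, Real.sq_sqrt hg.eps_pos.le]
  exact hg.coercive x v

theorem continuous_speed (hg : IsSquaredFinslerNorm g ε) {γ : ℝ → E} (hγ : ContDiff ℝ 1 γ) :
    Continuous fun s => √(g (γ s, deriv γ s)) :=
  (hg.contDiff.continuous.comp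
    (hγ.continuous.prodMk (hγ.continuous_deriv le_rfl))).sqrt

theorem length_nonneg (g : E × E → ℝ) (γ : ℝ → E) : 0 ≤ finslerLength g γ :=
  intervalIntegral.integral_nonneg zero_le_one fun _ _ => Real.sqrt_nonneg _

/-- Stated for every intermediate `s`, so that it confines an entire short path to a ball, not only
its endpoint. -/
theorem norm_sub_le_length [CompleteSpace E] (hg : IsSquaredFinslerNorm g ε) {γ : ℝ → E}
    (hγ : ContDiff ℝ 1 γ) {s : ℝ} (hs : s ∈ Icc (0 : ℝ) 1) :
    √ε * ‖γ s - γ 0‖ ≤ finslerLength g γ := by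
  have hc := hγ.continuous_deriv le_rfl
  have hsp := hg.continuous_speed hγ
  have h1 : ∫ u in (0 : ℝ)..s, deriv γ u = γ s - γ 0 :=
    intervalIntegral.integral_deriv_eq_sub (fun x _ => hγ.differentiable (by simp) x)
      (hc.intervalIntegrable _ _)
  rw [← h1]
  calc √ε * ‖∫ u in (0 : ℝ)..s, deriv γ u‖
      ≤ √ε * ∫ u in (0 : ℝ)..s, ‖deriv γ u‖ := by
        gcongr
        exact intervalIntegral.norm_integral_le_integral_norm hs.1
    _ = ∫ u in (0 : ℝ)..s, √ε * ‖deriv γ u‖ := by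
        rw [intervalIntegral.integral_const_mul]
    _ ≤ ∫ u in (0 : ℝ)..s, √(g (γ u, deriv γ u)) := by
        apply intervalIntegral.integral_mono_on hs.1
          ((continuous_const.mul hc.norm).intervalIntegrable _ _) (hsp.intervalIntegrable _ _)
        exact fun u _ => hg.sqrt_mul_norm_le _ _
    _ ≤ finslerLength g γ := by
        apply intervalIntegral.integral_mono_interval le_rfl hs.1 hs.2
          (Eventually.of_forall fun _ => Real.sqrt_nonneg _) (hsp.intervalIntegrable _ _)

theorem bddBelow_lengths (g : E × E → ℝ) (p q : E) :
    BddBelow {L : ℝ | ∃ γ : ℝ → E, ContDiff ℝ 1 γ ∧ γ 0 = p ∧ γ 1 = q ∧ L = finslerLength g γ} :=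
  ⟨0, by rintro _ ⟨γ, -, -, -, rfl⟩; exact length_nonneg g γ⟩

theorem dist_le_length (g : E × E → ℝ) {γ : ℝ → E} (hγ : ContDiff ℝ 1 γ) :
    finslerDist g (γ 0) (γ 1) ≤ finslerLength g γ :=
  csInf_le (bddBelow_lengths g _ _) ⟨γ, hγ, rfl, rfl, rfl⟩

theorem dist_nonneg (g : E × E → ℝ) (p q : E) : 0 ≤ finslerDist g p q :=
  Real.sInf_nonneg (by rintro _ ⟨γ, -, -, -, rfl⟩; exact length_nonneg g γ)

theorem contDiff_segment (p q : E) : ContDiff ℝ 1 fun s : ℝ => p + s • (q - p) := by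
  fun_prop

theorem exists_length_lt (g : E × E → ℝ) (p q : E) {η : ℝ} (hη : 0 < η) :
    ∃ γ : ℝ → E, ContDiff ℝ 1 γ ∧ γ 0 = p ∧ γ 1 = q ∧
      finslerLength g γ < finslerDist g p q + η := by
  obtain ⟨_, ⟨γ, h1, h2, h3, rfl⟩, h5⟩ := Real.lt_sInf_add_pos
    (s := {L : ℝ | ∃ γ : ℝ → E, ContDiff ℝ 1 γ ∧ γ 0 = p ∧ γ 1 = q ∧ L = finslerLength g γ})
    ⟨_, fun s : ℝ => p + s • (q - p), contDiff_segment p q, by simp, by simp, rfl⟩ hη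
  exact ⟨γ, h1, h2, h3, h5⟩

theorem norm_sub_le_dist [CompleteSpace E] (hg : IsSquaredFinslerNorm g ε) (p q : E) :
    √ε * ‖p - q‖ ≤ finslerDist g p q := by
  refine le_of_forall_pos_le_add fun η hη => ?_
  obtain ⟨γ, h1, rfl, rfl, h4⟩ := exists_length_lt g p q hη
  rw [norm_sub_rev]
  exact (hg.norm_sub_le_length h1 ⟨zero_le_one, le_rfl⟩).trans h4.le

/-- Reparametrising both paths by `Real.smoothTransition` makes the velocity vanish at the junction,
so the joined path is `C¹`; lengths do not change under monotone reparametrisation. -/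
theorem exists_concatenation (hg : IsSquaredFinslerNorm g ε) {α β : ℝ → E}
    (hα : ContDiff ℝ 1 α) (hβ : ContDiff ℝ 1 β) (h : α 1 = β 0) :
    ∃ γ : ℝ → E, ContDiff ℝ 1 γ ∧ γ 0 = α 0 ∧ γ 1 = β 1 ∧
      finslerLength g γ = finslerLength g α + finslerLength g β := by
  set σ := Real.smoothTransition with hσ
  have hσ1 : ContDiff ℝ 1 σ := Real.smoothTransition.contDiff
  have hσd : ∀ x, HasDerivAt σ (deriv σ x) x := fun x =>
    (hσ1.differentiable (by simp) x).hasDerivAt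
  have hσ0 : ∀ x ≤ 0, σ x = 0 := fun x => Real.smoothTransition.zero_of_nonpos
  have hσe : ∀ x, 1 ≤ x → σ x = 1 := fun x => Real.smoothTransition.one_of_one_le
  have hσp : ∀ x, 0 ≤ deriv σ x := fun x => Real.smoothTransition.monotone.deriv_nonneg
  have hαd : ∀ x, HasDerivAt α (deriv α x) x := fun x =>
    (hα.differentiable (by simp) x).hasDerivAt
  have hβd : ∀ x, HasDerivAt β (deriv β x) x := fun x =>
    (hβ.differentiable (by simp) x).hasDerivAt
  -- No case split is needed: the second term is constantly `β 0` up to `s = 1/2`, and the first is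
  -- constantly `α 1 = β 0` afterwards.
  set γ : ℝ → E := fun s => α (σ (2 * s)) + β (σ (2 * s - 1)) - β 0 with hγ
  have hγ1 : ContDiff ℝ 1 γ := by
    have a1 : ContDiff ℝ 1 fun s : ℝ => α (σ (2 * s)) := hα.comp (hσ1.comp (by fun_prop))
    have a2 : ContDiff ℝ 1 fun s : ℝ => β (σ (2 * s - 1)) := hβ.comp (hσ1.comp (by fun_prop))
    exact (a1.add a2).sub contDiff_const
  have hl : ∀ s : ℝ, HasDerivAt (fun s => σ (2 * s)) (deriv σ (2 * s) * 2) s := fun s => by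
    have h2 : HasDerivAt (fun s : ℝ => 2 * s) 2 s := by
      simpa using (hasDerivAt_id s).const_mul (2 : ℝ)
    exact (hσd (2 * s)).comp s h2
  have hr : ∀ s : ℝ, HasDerivAt (fun s => σ (2 * s - 1)) (deriv σ (2 * s - 1) * 2) s := fun s => by
    have h2 : HasDerivAt (fun s : ℝ => 2 * s - 1) 2 s := by
      simpa using ((hasDerivAt_id s).const_mul (2 : ℝ)).sub_const 1
    exact (hσd (2 * s - 1)).comp s h2
  have hγd : ∀ s, deriv γ s = (deriv σ (2 * s) * 2) • deriv α (σ (2 * s)) +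
      (deriv σ (2 * s - 1) * 2) • deriv β (σ (2 * s - 1)) := fun s =>
    ((((hαd _).scomp s (hl s)).add ((hβd _).scomp s (hr s))).sub_const _).deriv
  have hsq : ∀ (x v : E) (c : ℝ), 0 ≤ c → √(g (x, c • v)) = √(g (x, v)) * c := by
    intro x v c hc
    rw [hg.map_smul, Real.sqrt_mul (sq_nonneg c), Real.sqrt_sq hc, mul_comm]
  have hsα := hg.continuous_speed hα
  have hsβ := hg.continuous_speed hβ
  have hσ'c : Continuous (deriv σ) := hσ1.continuous_deriv le_rfl
  refine ⟨γ, hγ1, ?_, ?_, ?_⟩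
  · simp [hγ, hσ0]
  · have h2 : σ (2 * 1 - 1) = 1 := hσe _ (by norm_num)
    have h3 : σ (2 * 1) = 1 := hσe _ (by norm_num)
    simp only [hγ, h2, h3, h]
    abel
  · have hint := hg.continuous_speed hγ1
    have hsplit := intervalIntegral.integral_add_adjacent_intervals
      (hint.intervalIntegrable (μ := volume) 0 (1 / 2)) (hint.intervalIntegrable (1 / 2) 1)
    rw [finslerLength, ← hsplit]
    congr 1
    · have hcv := intervalIntegral.integral_comp_mul_deriv (a := 0) (b := 1 / 2)
        (fun x _ => hl x) (by fun_prop : Continuous fun s => deriv σ (2 * s) * 2).continuousOn hsα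
      rw [hσ0 (2 * 0) (by norm_num), hσe (2 * (1 / 2)) (by norm_num)] at hcv
      rw [finslerLength, ← hcv]
      refine intervalIntegral.integral_congr fun s hs => ?_
      rw [uIcc_of_le (by norm_num)] at hs
      have hz : 2 * s - 1 ≤ 0 := by linarith [hs.2]
      have hd0 : deriv σ (2 * s - 1) = 0 := (hasDerivAt_smoothTransition_of_nonpos hz).deriv
      have hγs : γ s = α (σ (2 * s)) := by simp [hγ, hσ0 _ hz]
      simp only [Function.comp]
      rw [hγd, hγs, hd0, zero_mul, zero_smul, add_zero, hsq _ _ _ (mul_nonneg (hσp _) zero_le_two)]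
    · have hcv := intervalIntegral.integral_comp_mul_deriv (a := 1 / 2) (b := 1)
        (fun x _ => hr x) (by fun_prop : Continuous fun s => deriv σ (2 * s - 1) * 2).continuousOn
        hsβ
      rw [hσ0 (2 * (1 / 2) - 1) (by norm_num), hσe (2 * 1 - 1) (by norm_num)] at hcv
      rw [finslerLength, ← hcv]
      refine intervalIntegral.integral_congr fun s hs => ?_
      rw [uIcc_of_le (by norm_num)] at hs
      have hz : 1 ≤ 2 * s := by linarith [hs.1]
      have hd0 : deriv σ (2 * s) = 0 := (hasDerivAt_smoothTransition_of_one_le hz).deriv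
      have hγs : γ s = β (σ (2 * s - 1)) := by
        simp only [hγ, hσe _ hz, h]
        abel
      simp only [Function.comp]
      rw [hγd, hγs, hd0, zero_mul, zero_smul, zero_add, hsq _ _ _ (mul_nonneg (hσp _) zero_le_two)]

theorem dist_triangle (hg : IsSquaredFinslerNorm g ε) (p q r : E) :
    finslerDist g p r ≤ finslerDist g p q + finslerDist g q r := by
  refine le_of_forall_pos_le_add fun η hη => ?_
  obtain ⟨α, a1, rfl, a3, a4⟩ := exists_length_lt g p q (half_pos hη)
  obtain ⟨β, b1, b2, rfl, b4⟩ := exists_length_lt g q r (half_pos hη)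
  obtain ⟨γ, c1, c2, c3, c4⟩ := hg.exists_concatenation a1 b1 (a3.trans b2.symm)
  have := dist_le_length g c1
  rw [c2, c3, c4] at this
  linarith

/-- Compactness bounds `g` on unit vectors over the ball; homogeneity extends the bound to all `v`.
-/
theorem exists_le_mul_norm_sq [ProperSpace E] (hg : IsSquaredFinslerNorm g ε) (ρ : ℝ) :
    ∃ m : ℝ, 0 < m ∧ ∀ x, ‖x‖ ≤ ρ → ∀ v, g (x, v) ≤ m * ‖v‖ ^ 2 := by
  have hK : IsCompact (Metric.closedBall (0 : E) ρ ×ˢ Metric.closedBall (0 : E) 1) :=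
    (isCompact_closedBall _ _).prod (isCompact_closedBall _ _)
  obtain ⟨C, hC⟩ := hK.exists_bound_of_continuousOn hg.contDiff.continuous.continuousOn
  refine ⟨max C 1, by positivity, fun x hx v => ?_⟩
  rcases eq_or_ne v 0 with rfl | hv
  · simp [hg.map_zero]
  · have hn : ‖v‖ ≠ 0 := norm_ne_zero_iff.2 hv
    have h1 := hC (x, ‖v‖⁻¹ • v) ⟨by simpa using hx, by simp [norm_smul, hn]⟩
    have h2 : g (x, v) = ‖v‖ ^ 2 * g (x, ‖v‖⁻¹ • v) := by
      rw [← hg.map_smul, smul_smul, mul_inv_cancel₀ hn, one_smul]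
    rw [h2, mul_comm]
    gcongr
    exact (le_abs_self _).trans (h1.trans (le_max_left _ _))

/-- The straight segment stays in the ball by convexity, and its length bounds the distance. -/
theorem exists_dist_le_mul_norm_sub [ProperSpace E] (hg : IsSquaredFinslerNorm g ε) (ρ : ℝ) :
    ∃ m : ℝ, 0 < m ∧ ∀ p q, ‖p‖ ≤ ρ → ‖q‖ ≤ ρ → finslerDist g p q ≤ m * ‖p - q‖ := by
  obtain ⟨m, hm, h⟩ := hg.exists_le_mul_norm_sq ρ
  refine ⟨√m, by positivity, fun p q hp hq => ?_⟩
  have hd : ∀ s : ℝ, deriv (fun s : ℝ => p + s • (q - p)) s = q - p := fun s => by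
    simpa using (((hasDerivAt_id s).smul_const (q - p)).const_add p).deriv
  have h1 := dist_le_length g (contDiff_segment p q)
  simp only [zero_smul, add_zero, one_smul, add_sub_cancel] at h1
  refine h1.trans ?_
  calc finslerLength g (fun s : ℝ => p + s • (q - p)) ≤ ∫ _ in (0 : ℝ)..1, √m * ‖p - q‖ := by
        apply intervalIntegral.integral_mono_on zero_le_one
          ((hg.continuous_speed (contDiff_segment p q)).intervalIntegrable _ _)
          (continuous_const.intervalIntegrable _ _)
        intro s hs
        rw [hd]
        have hb : ‖p + s • (q - p)‖ ≤ ρ := by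
          have hc := (convex_closedBall (0 : E) ρ).add_smul_sub_mem (x := p) (y := q)
            (by simpa using hp) (by simpa using hq) hs
          simpa using hc
        rw [norm_sub_rev, Real.sqrt_le_left (by positivity), mul_pow, Real.sq_sqrt hm.le]
        exact h _ hb _
    _ = √m * ‖p - q‖ := by simp

end IsSquaredFinslerNorm

/-! ### Quadratic errors, forward solutions and Euler steps -/

/-- The second derivative in `h` is bounded on the compact set `[0, T] × K`; two applications of the
mean value inequality give one constant for all parameters. -/
theorem exists_taylor_bound {P : Type*} [NormedAddCommGroup P] [NormedSpace ℝ P]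
    {Φ : ℝ × P → ℝ} (hΦ : ContDiff ℝ 2 Φ) {K : Set P} (hK : IsCompact K) (T : ℝ) :
    ∃ C : ℝ, 0 ≤ C ∧ ∀ p ∈ K, ∀ h ∈ Icc (0 : ℝ) T,
      |Φ (h, p) - Φ (0, p) - h * deriv (fun s => Φ (s, p)) 0| ≤ C * h ^ 2 := by
  set D : ℝ × P → ℝ := fun q => fderiv ℝ Φ q (1, 0) with hD
  have hD1 : ContDiff ℝ 1 D := (hΦ.fderiv_right (m := 1) (by norm_num)).clm_apply contDiff_const
  set D2 : ℝ × P → ℝ := fun q => fderiv ℝ D q (1, 0) with hD2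
  have hD2c : Continuous D2 := (hD1.continuous_fderiv (by simp)).clm_apply continuous_const
  have hline : ∀ (p : P) (s : ℝ), HasDerivAt (fun s : ℝ => ((s, p) : ℝ × P)) (1, 0) s :=
    fun p s => (hasDerivAt_id s).prodMk (hasDerivAt_const s p)
  have hΦd : ∀ p s, HasDerivAt (fun s => Φ (s, p)) (D (s, p)) s := fun p s =>
    ((hΦ.differentiable (by simp)) (s, p)).hasFDerivAt.comp_hasDerivAt s (hline p s)
  have hDd : ∀ p s, HasDerivAt (fun s => D (s, p)) (D2 (s, p)) s := fun p s =>
    HasFDerivAt.comp_hasDerivAt (f := fun s : ℝ => (s, p)) s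
      ((hD1.differentiable (by simp)) (s, p)).hasFDerivAt (hline p s)
  obtain ⟨C, hC⟩ := ((isCompact_Icc (a := (0 : ℝ)) (b := T)).prod hK).exists_bound_of_continuousOn
    hD2c.continuousOn
  refine ⟨max C 0, le_max_right _ _, fun p hp h hh => ?_⟩
  have h1 : ∀ s ∈ Icc (0 : ℝ) h, |D (s, p) - D (0, p)| ≤ max C 0 * h := fun s hs => by
    have := norm_image_sub_le_of_norm_deriv_le_segment' (a := 0) (b := h) (C := max C 0)
      (fun s _ => (hDd p s).hasDerivWithinAt)
      (fun s hs => (hC (s, p) ⟨⟨hs.1, hs.2.le.trans hh.2⟩, hp⟩).trans (le_max_left _ _)) s hs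
    rw [Real.norm_eq_abs, sub_zero] at this
    exact this.trans (mul_le_mul_of_nonneg_left hs.2 (le_max_right _ _))
  have h2 := norm_image_sub_le_of_norm_deriv_le_segment' (a := 0) (b := h) (C := max C 0 * h)
    (f := fun s => Φ (s, p) - s * D (0, p)) (f' := fun s => D (s, p) - D (0, p))
    (fun s _ => ((hΦd p s).sub (by simpa using (hasDerivAt_id s).mul_const _)).hasDerivWithinAt)
    (fun s hs => h1 s (Ico_subset_Icc_self hs)) h ⟨hh.1, le_rfl⟩
  rw [(hΦd p 0).deriv]
  rw [Real.norm_eq_abs] at h2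
  calc _ = |Φ (h, p) - h * D (0, p) - (Φ (0, p) - 0 * D (0, p))| := by ring_nf
    _ ≤ _ := h2
    _ = _ := by ring

/-- A function that grows by at most a quadratic amount on short intervals does not grow. -/
theorem le_of_forall_sub_le_sq {a : ℝ → ℝ} {C T : ℝ} (hT : 0 ≤ T)
    (h : ∀ s t, 0 ≤ s → s ≤ t → t ≤ T → a t - a s ≤ C * (t - s) ^ 2) : a T ≤ a 0 := by
  -- With `N + 1` equal steps of length `T / (N + 1)`, the errors add up to `C T² / (N + 1)`.
  have key : ∀ N : ℕ, a T - a 0 ≤ C * T ^ 2 / ((N : ℝ) + 1) := fun N => by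
    have hN : (0 : ℝ) < (N : ℝ) + 1 := by positivity
    set δ := T / ((N : ℝ) + 1) with hδ
    have hδ0 : 0 ≤ δ := by positivity
    have hδN : ((N : ℝ) + 1) * δ = T := by rw [hδ]; field_simp
    have ind : ∀ k : ℕ, k ≤ N + 1 → a (k * δ) - a 0 ≤ k * (C * δ ^ 2) := by
      intro k
      induction k with
      | zero => simp
      | succ k ih =>
        intro hk
        have h1 := ih (by omega)
        have hk' : ((k : ℝ) + 1) ≤ (N : ℝ) + 1 := by exact_mod_cast hk
        have h2 := h (k * δ) ((k + 1 : ℕ) * δ) (by positivity) (by push_cast; linarith)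
          (by push_cast; rw [← hδN]; gcongr)
        have h3 : ((k + 1 : ℕ) * δ - k * δ : ℝ) = δ := by push_cast; ring
        rw [h3] at h2
        push_cast at h2 ⊢
        linarith
    have h1 := ind (N + 1) le_rfl
    push_cast at h1
    rw [hδN] at h1
    refine h1.trans (le_of_eq ?_)
    rw [hδ]
    field_simp
  have hlim : Tendsto (fun N : ℕ => C * T ^ 2 / ((N : ℝ) + 1)) atTop (𝓝 0) :=
    tendsto_const_nhds.div_atTop (tendsto_natCast_atTop_atTop.atTop_add tendsto_const_nhds)
  linarith [ge_of_tendsto' hlim key]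

/-- The derivative of the squared Finsler norm of a tangent vector `v` at `x` that is carried along
by the flow of the vector field `f`. -/
noncomputable def finslerVariation {E : Type*} [NormedAddCommGroup E] [NormedSpace ℝ E]
    (f : E → E) (g : E × E → ℝ) (x v : E) : ℝ :=
  fderiv ℝ g (x, v) (f x, fderiv ℝ f x v)

/-- A solution of the autonomous equation `ẋ = f(x)` on `[0, ∞)`. -/
def IsForwardSolution {E : Type*} [NormedAddCommGroup E] [NormedSpace ℝ E]
    (f : E → E) (x : ℝ → E) : Prop :=
  ∀ t, 0 ≤ t → HasDerivWithinAt x (f (x t)) (Ici 0) t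

namespace IsForwardSolution

variable {E : Type*} [NormedAddCommGroup E] [NormedSpace ℝ E] {f : E → E} {x : ℝ → E}

theorem continuousOn (hx : IsForwardSolution f x) : ContinuousOn x (Ici 0) :=
  fun t ht => (hx t ht).continuousWithinAt

theorem shift (hx : IsForwardSolution f x) {s : ℝ} (hs : 0 ≤ s) :
    IsForwardSolution f fun t => x (s + t) := by
  intro t ht
  have h1 : HasDerivWithinAt (fun t : ℝ => s + t) 1 (Ici 0) t :=
    ((hasDerivAt_id t).const_add s).hasDerivWithinAt
  have h2 := (hx (s + t) (add_nonneg hs ht)).scomp t h1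
    (fun u (hu : 0 ≤ u) => add_nonneg hs hu)
  rw [one_smul] at h2
  exact h2

theorem const {p : E} (hp : f p = 0) : IsForwardSolution f fun _ => p := fun t _ => by
  rw [hp]
  exact hasDerivWithinAt_const _ _ _

theorem exists_bound (hx : IsForwardSolution f x) (T : ℝ) :
    ∃ ρ, ∀ t ∈ Icc (0 : ℝ) T, ‖x t‖ ≤ ρ :=
  isCompact_Icc.exists_bound_of_continuousOn (hx.continuousOn.mono fun _ h => h.1)

theorem hasDerivWithinAt_comp_field (hf : ContDiff ℝ 1 f) (hx : IsForwardSolution f x) {t : ℝ}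
    (ht : 0 ≤ t) :
    HasDerivWithinAt (fun s => f (x s)) (fderiv ℝ f (x t) (f (x t))) (Ici 0) t :=
  ((hf.differentiable (by simp)) (x t)).hasFDerivAt.comp_hasDerivWithinAt t (hx t ht)

end IsForwardSolution

/-- Along a solution `f ∘ x` has derivative `Df(x) f(x)`, which is bounded on the ball; hence `C`
depends on `f` and `ρ` but not on the solution. -/
theorem exists_euler_error_bound {E : Type*} [NormedAddCommGroup E] [NormedSpace ℝ E]
    [ProperSpace E] {f : E → E} (hf : ContDiff ℝ 1 f) (ρ : ℝ) :
    ∃ C : ℝ, 0 ≤ C ∧ ∀ x : ℝ → E, IsForwardSolution f x → ∀ t h : ℝ, 0 ≤ t → 0 ≤ h →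
      (∀ s ∈ Icc t (t + h), ‖x s‖ ≤ ρ) → ‖x t + h • f (x t) - x (t + h)‖ ≤ C * h ^ 2 := by
  have hc : Continuous fun z => fderiv ℝ f z (f z) :=
    (hf.continuous_fderiv (by simp)).clm_apply hf.continuous
  obtain ⟨C, hC⟩ := (isCompact_closedBall (0 : E) ρ).exists_bound_of_continuousOn hc.continuousOn
  refine ⟨max C 0, le_max_right _ _, fun x hx t h ht hh hb => ?_⟩
  have hsub : Icc t (t + h) ⊆ Ici 0 := fun s hs => ht.trans hs.1
  have h1 : ∀ s ∈ Icc t (t + h), ‖f (x s) - f (x t)‖ ≤ max C 0 * h := fun s hs => by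
    have := norm_image_sub_le_of_norm_deriv_le_segment' (a := t) (b := t + h) (C := max C 0)
      (fun s hs => (hx.hasDerivWithinAt_comp_field hf (hsub hs)).mono hsub)
      (fun s hs => (hC (x s) (by simpa using hb s (Ico_subset_Icc_self hs))).trans
        (le_max_left _ _)) s hs
    refine this.trans (mul_le_mul_of_nonneg_left ?_ (le_max_right _ _))
    linarith [hs.2]
  have h2 := norm_image_sub_le_of_norm_deriv_le_segment' (a := t) (b := t + h) (C := max C 0 * h)
    (f := fun s => x s - (s - t) • f (x t)) (f' := fun s => f (x s) - f (x t))
    (fun s hs => ((hx s (hsub hs)).mono hsub).sub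
      (by simpa using (((hasDerivAt_id s).sub_const t).smul_const (f (x t))).hasDerivWithinAt))
    (fun s hs => h1 s (Ico_subset_Icc_self hs)) (t + h) ⟨by linarith, le_rfl⟩
  rw [norm_sub_rev]
  calc _ = ‖x (t + h) - (t + h - t) • f (x t) - (x t - (t - t) • f (x t))‖ := by
        congr 1
        simp only [add_sub_cancel_left, sub_self, zero_smul, sub_zero]
        abel
    _ ≤ _ := h2
    _ = _ := by ring

/-! ### Contraction of distances -/

namespace IsSquaredFinslerNorm

variable {E : Type*} [NormedAddCommGroup E] [NormedSpace ℝ E] {g : E × E → ℝ} {ε : ℝ}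
  {f : E → E}

/-- The Euler map acts on tangent vectors by `v ↦ v + h Df(x) v` and agrees with the flow to first
order, so it produces the same variation of `g`. -/
theorem hasDerivAt_euler (hg : IsSquaredFinslerNorm g ε) (x v : E) :
    HasDerivAt (fun h : ℝ => g (x + h • f x, v + h • fderiv ℝ f x v))
      (finslerVariation f g x v) 0 := by
  have h1 : HasDerivAt (fun h : ℝ => (x + h • f x, v + h • fderiv ℝ f x v))
      (f x, fderiv ℝ f x v) 0 := by
    refine HasDerivAt.prodMk ?_ ?_
    · simpa using ((hasDerivAt_id (0 : ℝ)).smul_const (f x)).const_add x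
    · simpa using ((hasDerivAt_id (0 : ℝ)).smul_const (fderiv ℝ f x v)).const_add v
  have h2 : HasFDerivAt g (fderiv ℝ g (x, v))
      ((fun h : ℝ => (x + h • f x, v + h • fderiv ℝ f x v)) 0) := by
    simpa using ((hg.contDiff.differentiable (by simp)) (x, v)).hasFDerivAt
  exact h2.comp_hasDerivAt 0 h1

/-- Taylor expansion in `h` on unit vectors, extended by homogeneity. `f` has to be `C³` because the
expanded function contains `Df` and must be `C²`. -/
theorem exists_euler_speed_bound [ProperSpace E] (hg : IsSquaredFinslerNorm g ε)
    (hf : ContDiff ℝ 3 f) {ρ β : ℝ}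
    (hβ : ∀ x, ‖x‖ ≤ ρ → ∀ v, finslerVariation f g x v ≤ -β * g (x, v)) (T : ℝ) :
    ∃ C : ℝ, 0 ≤ C ∧ ∀ x, ‖x‖ ≤ ρ → ∀ v, ∀ h ∈ Icc (0 : ℝ) T,
      √(g (x + h • f x, v + h • fderiv ℝ f x v)) ≤
        (Real.exp (-(β / 2 * h)) + C * h ^ 2) * √(g (x, v)) := by
  have hε := hg.eps_pos
  have hΦ : ContDiff ℝ 2 fun q : ℝ × E × E =>
      g (q.2.1 + q.1 • f q.2.1, q.2.2 + q.1 • fderiv ℝ f q.2.1 q.2.2) := by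
    have hf2 : ContDiff ℝ 2 f := hf.of_le (by norm_num)
    have hf' : ContDiff ℝ 2 (fderiv ℝ f) := hf.fderiv_right (by norm_num)
    have hx : ContDiff ℝ 2 fun q : ℝ × E × E => q.2.1 := by fun_prop
    have hv : ContDiff ℝ 2 fun q : ℝ × E × E => q.2.2 := by fun_prop
    have hh : ContDiff ℝ 2 fun q : ℝ × E × E => q.1 := by fun_prop
    exact hg.contDiff.comp ((hx.add (hh.smul (hf2.comp hx))).prodMk
      (hv.add (hh.smul ((hf'.comp hx).clm_apply hv))))
  have hK : IsCompact (Metric.closedBall (0 : E) ρ ×ˢ Metric.closedBall (0 : E) 1) :=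
    (isCompact_closedBall _ _).prod (isCompact_closedBall _ _)
  obtain ⟨C, hC0, hC⟩ := exists_taylor_bound hΦ hK T
  -- `C / ε` turns the absolute Taylor error into a multiple of `g (x, v) ≥ ε`; `β ^ 2` keeps `1 -
  -- βh/2 + C'h²/2` nonnegative, as is needed for taking the square root.
  set C' := max (C / ε) (β ^ 2) with hC'
  have hC'0 : 0 ≤ C' := (sq_nonneg β).trans (le_max_right _ _)
  have unit : ∀ x, ‖x‖ ≤ ρ → ∀ v, ‖v‖ = 1 → ∀ h ∈ Icc (0 : ℝ) T,
      g (x + h • f x, v + h • fderiv ℝ f x v) ≤ (1 - β * h + C' * h ^ 2) * g (x, v) := by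
    intro x hx v hv h hh
    have h1 := hC (x, v) ⟨by simpa using hx, by simp [hv]⟩ h hh
    simp only [zero_smul, add_zero] at h1
    rw [(hg.hasDerivAt_euler x v).deriv] at h1
    have h2 := (abs_le.1 h1).2
    have h3 : C * h ^ 2 ≤ C' * h ^ 2 * g (x, v) := by
      have h4 := hg.coercive x v
      rw [hv] at h4
      calc C * h ^ 2 = C / ε * h ^ 2 * (ε * 1 ^ 2) := by field_simp
        _ ≤ C' * h ^ 2 * g (x, v) := by
          gcongr
          exact le_max_left _ _
    have h4 := mul_le_mul_of_nonneg_left (hβ x hx v) hh.1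
    linarith
  refine ⟨C' / 2, by positivity, fun x hx v h hh => ?_⟩
  have all : g (x + h • f x, v + h • fderiv ℝ f x v) ≤
      (1 - β * h + C' * h ^ 2) * g (x, v) := by
    rcases eq_or_ne v 0 with rfl | hv
    · simp [hg.map_zero]
    · have hn : ‖v‖ ≠ 0 := norm_ne_zero_iff.2 hv
      have h1 := unit x hx (‖v‖⁻¹ • v) (by simp [norm_smul, hn]) h hh
      have h2 : ‖v‖⁻¹ • v + h • fderiv ℝ f x (‖v‖⁻¹ • v) =
          ‖v‖⁻¹ • (v + h • fderiv ℝ f x v) := by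
        rw [_root_.map_smul, smul_add, smul_comm]
      rw [h2, hg.map_smul, hg.map_smul, mul_left_comm] at h1
      exact le_of_mul_le_mul_left h1 (by positivity)
  have hb : β ^ 2 * h ^ 2 ≤ C' * h ^ 2 := by
    gcongr
    exact le_max_right _ _
  have hB0 : 0 ≤ 1 - β / 2 * h + C' / 2 * h ^ 2 := by nlinarith [sq_nonneg (β * h - 1)]
  have hB : 1 - β / 2 * h + C' / 2 * h ^ 2 ≤ Real.exp (-(β / 2 * h)) + C' / 2 * h ^ 2 := by
    linarith [Real.add_one_le_exp (-(β / 2 * h))]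
  refine le_trans ?_ (mul_le_mul_of_nonneg_right hB (Real.sqrt_nonneg _))
  rw [Real.sqrt_le_left (by positivity), mul_pow, Real.sq_sqrt (hg.nonneg _ _)]
  refine all.trans (mul_le_mul_of_nonneg_right ?_ (hg.nonneg _ _))
  -- This is `1 + 2w ≤ (1 + w)²` for `w = -βh/2 + C'h²/2`.
  nlinarith [sq_nonneg (- β / 2 * h + C' / 2 * h ^ 2)]

theorem exists_euler_length_bound [ProperSpace E] (hg : IsSquaredFinslerNorm g ε)
    (hf : ContDiff ℝ 3 f) {ρ β : ℝ}
    (hβ : ∀ x, ‖x‖ ≤ ρ → ∀ v, finslerVariation f g x v ≤ -β * g (x, v)) (T : ℝ) :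
    ∃ C : ℝ, 0 ≤ C ∧ ∀ γ : ℝ → E, ContDiff ℝ 1 γ → (∀ s ∈ Icc (0 : ℝ) 1, ‖γ s‖ ≤ ρ) →
      ∀ h ∈ Icc (0 : ℝ) T, finslerLength g (fun s => γ s + h • f (γ s)) ≤
        (Real.exp (-(β / 2 * h)) + C * h ^ 2) * finslerLength g γ := by
  obtain ⟨C, hC0, hC⟩ := hg.exists_euler_speed_bound hf hβ T
  refine ⟨C, hC0, fun γ hγ hγb h hh => ?_⟩
  have hf1 : ContDiff ℝ 1 f := hf.of_le (by norm_num)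
  have hΓ : ContDiff ℝ 1 fun s => γ s + h • f (γ s) := hγ.add ((hf1.comp hγ).const_smul h)
  have hd : ∀ s, deriv (fun s => γ s + h • f (γ s)) s =
      deriv γ s + h • fderiv ℝ f (γ s) (deriv γ s) := fun s => by
    have h1 := (hγ.differentiable (by simp) s).hasDerivAt
    exact (h1.add ((((hf1.differentiable (by simp)) (γ s)).hasFDerivAt.comp_hasDerivAt s
      h1).const_smul h)).deriv
  rw [finslerLength, finslerLength, ← intervalIntegral.integral_const_mul]
  apply intervalIntegral.integral_mono_on zero_le_one
    ((hg.continuous_speed hΓ).intervalIntegrable _ _)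
    ((continuous_const.mul (hg.continuous_speed hγ)).intervalIntegrable _ _)
  intro s hs
  rw [hd]
  exact hC _ (hγb s hs) _ h hh

/-- Contraction of the distance of two trajectories, with a rate that is valid on a ball in which
both trajectories and all nearly minimal paths between them remain. -/
theorem dist_le_exp_mul_dist [ProperSpace E] (hg : IsSquaredFinslerNorm g ε)
    (hf : ContDiff ℝ 3 f) {x y : ℝ → E} (hx : IsForwardSolution f x) (hy : IsForwardSolution f y)
    {ρ β T : ℝ} (hT : 0 ≤ T)
    (hρ : ∀ t ∈ Icc (0 : ℝ) T, ‖x t‖ + (finslerDist g (x t) (y t) + 1) / √ε ≤ ρ)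
    (hβ : ∀ x, ‖x‖ ≤ ρ → ∀ v, finslerVariation f g x v ≤ -β * g (x, v)) :
    finslerDist g (x T) (y T) ≤ Real.exp (-(β / 2 * T)) * finslerDist g (x 0) (y 0) := by
  have hε := hg.eps_pos
  have hsε : 0 < √ε := Real.sqrt_pos.2 hε
  have hf1 : ContDiff ℝ 1 f := hf.of_le (by norm_num)
  have hxb : ∀ t ∈ Icc (0 : ℝ) T, ‖x t‖ ≤ ρ := fun t ht => by
    have := dist_nonneg g (x t) (y t)
    have h2 : 0 ≤ (finslerDist g (x t) (y t) + 1) / √ε := by positivity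
    linarith [hρ t ht]
  have hyb : ∀ t ∈ Icc (0 : ℝ) T, ‖y t‖ ≤ ρ := fun t ht => by
    have h1 : ‖x t - y t‖ ≤ (finslerDist g (x t) (y t) + 1) / √ε := by
      rw [le_div_iff₀ hsε, mul_comm]
      linarith [hg.norm_sub_le_dist (x t) (y t)]
    have h2 : ‖y t‖ ≤ ‖x t‖ + ‖x t - y t‖ := by
      rw [norm_sub_rev]
      exact norm_le_norm_add_norm_sub' _ _
    linarith [hρ t ht]
  obtain ⟨C, hC0, hC⟩ := hg.exists_euler_length_bound hf hβ T
  obtain ⟨C₁, hC₁0, hC₁⟩ := exists_euler_error_bound hf1 ρ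
  obtain ⟨F, hF⟩ := (isCompact_closedBall (0 : E) ρ).exists_bound_of_continuousOn
    hf.continuous.continuousOn
  -- The radius is enlarged because an Euler step may leave the ball of radius `ρ`.
  obtain ⟨m, hm0, hm⟩ := hg.exists_dist_le_mul_norm_sub (ρ + T * max F 0)
  have hTF : 0 ≤ T * max F 0 := mul_nonneg hT (le_max_right _ _)
  have hstep : ∀ z, ‖z‖ ≤ ρ → ∀ h ∈ Icc (0 : ℝ) T, ‖z + h • f z‖ ≤ ρ + T * max F 0 := by
    intro z hz h hh
    refine (norm_add_le _ _).trans (add_le_add hz ?_)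
    rw [norm_smul, Real.norm_of_nonneg hh.1]
    exact mul_le_mul hh.2 ((hF z (by simpa using hz)).trans (le_max_left _ _)) (norm_nonneg _) hT
  -- This a priori bound turns the relative error `C h² d` into an additive one that is uniform in
  -- time.
  have hD : ∀ t ∈ Icc (0 : ℝ) T, finslerDist g (x t) (y t) ≤ √ε * ρ := fun t ht => by
    have h1 : (finslerDist g (x t) (y t) + 1) / √ε ≤ ρ := by linarith [hρ t ht, norm_nonneg (x t)]
    rw [div_le_iff₀ hsε] at h1
    linarith
  have main : ∀ t h, 0 ≤ t → 0 ≤ h → t + h ≤ T →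
      finslerDist g (x (t + h)) (y (t + h)) ≤
        Real.exp (-(β / 2 * h)) * finslerDist g (x t) (y t) +
          (C * (√ε * ρ) + 2 * (m * C₁)) * h ^ 2 := by
    intro t h ht hh hth
    have htT : t ∈ Icc (0 : ℝ) T := ⟨ht, by linarith⟩
    have hhT : h ∈ Icc (0 : ℝ) T := ⟨hh, by linarith⟩
    have hthT : t + h ∈ Icc (0 : ℝ) T := ⟨by linarith, hth⟩
    have hsub : Icc t (t + h) ⊆ Icc 0 T := Icc_subset_Icc ht hth
    set d := finslerDist g (x t) (y t) with hd
    have ends : ∀ z : ℝ → E, IsForwardSolution f z → (∀ t ∈ Icc (0 : ℝ) T, ‖z t‖ ≤ ρ) →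
        ‖z t + h • f (z t)‖ ≤ ρ + T * max F 0 ∧ ‖z (t + h)‖ ≤ ρ + T * max F 0 ∧
          ‖z t + h • f (z t) - z (t + h)‖ ≤ C₁ * h ^ 2 := fun z hz hzb =>
      ⟨hstep _ (hzb t htT) h hhT, by linarith [hzb _ hthT],
        hC₁ z hz t h ht hh fun s hs => hzb s (hsub hs)⟩
    obtain ⟨ex1, ex2, ex3⟩ := ends x hx hxb
    obtain ⟨ey1, ey2, ey3⟩ := ends y hy hyb
    have hdx : finslerDist g (x (t + h)) (x t + h • f (x t)) ≤ m * (C₁ * h ^ 2) := by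
      refine (hm _ _ ex2 ex1).trans ?_
      rw [norm_sub_rev]
      gcongr
    have hdy : finslerDist g (y t + h • f (y t)) (y (t + h)) ≤ m * (C₁ * h ^ 2) :=
      (hm _ _ ey1 ey2).trans (by gcongr)
    have hmid : finslerDist g (x t + h • f (x t)) (y t + h • f (y t)) ≤
        (Real.exp (-(β / 2 * h)) + C * h ^ 2) * d := by
      -- A path of length below `d + 1` that starts at `x t` stays in the ball of radius `ρ`; this
      -- is why `hρ` contains `+ 1`.
      have hη : ∀ η ∈ Ioo (0 : ℝ) 1, finslerDist g (x t + h • f (x t)) (y t + h • f (y t)) ≤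
          (Real.exp (-(β / 2 * h)) + C * h ^ 2) * (d + η) := by
        intro η hη
        obtain ⟨γ, g1, g2, g3, g4⟩ := exists_length_lt g (x t) (y t) hη.1
        have hγb : ∀ s ∈ Icc (0 : ℝ) 1, ‖γ s‖ ≤ ρ := fun s hs => by
          have h1 := hg.norm_sub_le_length g1 hs
          have h2 : ‖γ s - γ 0‖ ≤ (d + 1) / √ε := by
            rw [le_div_iff₀ hsε, mul_comm]
            linarith [hη.2]
          have h3 : ‖γ s‖ ≤ ‖γ 0‖ + ‖γ s - γ 0‖ := norm_le_norm_add_norm_sub' _ _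
          rw [g2] at h3 h2
          linarith [hρ t htT]
        have h1 := hC γ g1 hγb h hhT
        have h2 := dist_le_length g (γ := fun s => γ s + h • f (γ s))
          (g1.add ((hf1.comp g1).const_smul h))
        simp only [g2, g3] at h2
        exact h2.trans (h1.trans (by gcongr))
      have hlim : Tendsto (fun η : ℝ => (Real.exp (-(β / 2 * h)) + C * h ^ 2) * (d + η))
          (𝓝[>] 0) (𝓝 ((Real.exp (-(β / 2 * h)) + C * h ^ 2) * (d + 0))) :=
        ((by fun_prop : Continuous fun η : ℝ =>
          (Real.exp (-(β / 2 * h)) + C * h ^ 2) * (d + η)).tendsto 0).mono_left nhdsWithin_le_nhds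
      rw [add_zero] at hlim
      exact ge_of_tendsto hlim (by
        filter_upwards [Ioo_mem_nhdsGT (zero_lt_one' ℝ)] with η h using hη η h)
    have tri1 := hg.dist_triangle (x (t + h)) (x t + h • f (x t)) (y (t + h))
    have tri2 := hg.dist_triangle (x t + h • f (x t)) (y t + h • f (y t)) (y (t + h))
    have hCd : C * h ^ 2 * d ≤ C * h ^ 2 * (√ε * ρ) := by
      gcongr
      exact hD t htT
    linarith
  set C' := C * (√ε * ρ) + 2 * (m * C₁) with hC'
  have hC'0 : 0 ≤ C' := by
    have : 0 ≤ √ε * ρ := (dist_nonneg g _ _).trans (hD 0 ⟨le_rfl, hT⟩)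
    positivity
  -- The weight `e^{βt/2}` absorbs the contraction factor of each step and leaves a quadratic
  -- increment. The sign of `β` is arbitrary, so the weight is bounded through `|β|`.
  have hfin := le_of_forall_sub_le_sq
    (a := fun t => Real.exp (β / 2 * t) * finslerDist g (x t) (y t))
    (C := Real.exp (|β| / 2 * T) * C') hT (by
      intro s t hs hst htT
      have h1 := main s (t - s) hs (by linarith) (by linarith)
      rw [add_sub_cancel] at h1
      have h2 : Real.exp (β / 2 * t) * Real.exp (-(β / 2 * (t - s))) = Real.exp (β / 2 * s) := by
        rw [← Real.exp_add]
        ring_nf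
      have h3 : Real.exp (β / 2 * t) ≤ Real.exp (|β| / 2 * T) := by
        apply Real.exp_le_exp.2
        have := le_abs_self β
        have : 0 ≤ t := hs.trans hst
        gcongr
      have h4 := mul_le_mul_of_nonneg_left h1 (Real.exp_nonneg (β / 2 * t))
      rw [mul_add, ← mul_assoc, h2] at h4
      have h5 : Real.exp (β / 2 * t) * (C' * (t - s) ^ 2) ≤
          Real.exp (|β| / 2 * T) * (C' * (t - s) ^ 2) := by gcongr
      linarith)
  simp only [mul_zero, Real.exp_zero, one_mul] at hfin
  rw [Real.exp_neg, inv_mul_eq_div, le_div_iff₀ (Real.exp_pos _), mul_comm]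
  exact hfin

end IsSquaredFinslerNorm

/-! ### Uniqueness and gluing of solutions -/

/-- Both curves are bounded on `[0, T]`, and a `C¹` field is Lipschitz on a ball that contains them.
-/
theorem eqOn_Icc_of_hasDerivWithinAt {E : Type*} [NormedAddCommGroup E] [NormedSpace ℝ E]
    [ProperSpace E] {f : E → E} (hf : ContDiff ℝ 1 f) {x y : ℝ → E} {T : ℝ}
    (hx : ∀ t ∈ Icc (0 : ℝ) T, HasDerivWithinAt x (f (x t)) (Icc 0 T) t)
    (hy : ∀ t ∈ Icc (0 : ℝ) T, HasDerivWithinAt y (f (y t)) (Icc 0 T) t)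
    (h0 : x 0 = y 0) : EqOn x y (Icc 0 T) := by
  have hxc : ContinuousOn x (Icc 0 T) := fun t ht => (hx t ht).continuousWithinAt
  have hyc : ContinuousOn y (Icc 0 T) := fun t ht => (hy t ht).continuousWithinAt
  obtain ⟨a, ha⟩ := isCompact_Icc.exists_bound_of_continuousOn hxc
  obtain ⟨b, hb⟩ := isCompact_Icc.exists_bound_of_continuousOn hyc
  obtain ⟨K, hK⟩ := hf.contDiffOn.exists_lipschitzOnWith one_ne_zero
    (convex_closedBall (0 : E) (max a b)) (isCompact_closedBall _ _)
  refine ODE_solution_unique_of_mem_Icc_right (v := fun _ => f)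
    (s := fun _ => Metric.closedBall (0 : E) (max a b)) (fun _ _ => hK) hxc
    (fun t ht => ?_) (fun t ht => ?_) hyc (fun t ht => ?_) (fun t ht => ?_) h0
  · exact (hx t (Ico_subset_Icc_self ht)).mono_of_mem_nhdsWithin (Icc_mem_nhdsGE_of_mem ht)
  · simpa using Or.inl (ha t (Ico_subset_Icc_self ht))
  · exact (hy t (Ico_subset_Icc_self ht)).mono_of_mem_nhdsWithin (Icc_mem_nhdsGE_of_mem ht)
  · simpa using Or.inr (hb t (Ico_subset_Icc_self ht))

theorem IsForwardSolution.eqOn {E : Type*} [NormedAddCommGroup E] [NormedSpace ℝ E]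
    [ProperSpace E] {f : E → E} (hf : ContDiff ℝ 1 f) {x y : ℝ → E}
    (hx : IsForwardSolution f x) (hy : IsForwardSolution f y) (h0 : x 0 = y 0) :
    EqOn x y (Ici 0) := fun t (ht : 0 ≤ t) =>
  eqOn_Icc_of_hasDerivWithinAt hf
    (fun s hs => (hx s hs.1).mono Icc_subset_Ici_self)
    (fun s hs => (hy s hs.1).mono Icc_subset_Ici_self) h0 ⟨ht, le_rfl⟩

/-- Solutions on all compact intervals `[0, T]` combine to a solution on `[0, ∞)`. -/
theorem IsForwardSolution.exists_of_forall_Icc {E : Type*} [NormedAddCommGroup E]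
    [NormedSpace ℝ E] [ProperSpace E] {f : E → E} (hf : ContDiff ℝ 1 f) {p : E}
    (h : ∀ T : ℝ, 0 ≤ T → ∃ x : ℝ → E, x 0 = p ∧
      ∀ t ∈ Icc (0 : ℝ) T, HasDerivWithinAt x (f (x t)) (Icc 0 T) t) :
    ∃ x : ℝ → E, IsForwardSolution f x ∧ x 0 = p := by
  choose z hz0 hz using fun N : ℕ => h N N.cast_nonneg
  have agree : ∀ (M N : ℕ) (t : ℝ), 0 ≤ t → t ≤ M → t ≤ N → z M t = z N t := by
    intro M N t ht hM hN
    exact eqOn_Icc_of_hasDerivWithinAt hf (T := t)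
      (fun s hs => (hz M s ⟨hs.1, hs.2.trans hM⟩).mono (Icc_subset_Icc_right hM))
      (fun s hs => (hz N s ⟨hs.1, hs.2.trans hN⟩).mono (Icc_subset_Icc_right hN))
      ((hz0 M).trans (hz0 N).symm) ⟨ht, le_rfl⟩
  -- Time `t` uses the solution on `[0, ⌊t⌋ + 1]`; by uniqueness it coincides near `t` with any
  -- fixed `z N`, `N > t`.
  refine ⟨fun t => z (⌊t⌋₊ + 1) t, fun t ht => ?_, hz0 _⟩
  obtain ⟨N, hN⟩ := exists_nat_gt t
  have hle : ∀ s : ℝ, s ≤ ((⌊s⌋₊ + 1 : ℕ) : ℝ) := fun s => by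
    push_cast
    exact (Nat.lt_floor_add_one s).le
  have heq : ∀ s : ℝ, 0 ≤ s → s ≤ N → z (⌊s⌋₊ + 1) s = z N s := fun s hs hsN =>
    agree _ _ s hs (hle s) hsN
  have h1 : HasDerivWithinAt (z N) (f (z N t)) (Ici 0) t := by
    refine (hz N t ⟨ht, hN.le⟩).mono_of_mem_nhdsWithin ?_
    rw [← Ici_inter_Iic]
    exact inter_mem_nhdsWithin _ (Iic_mem_nhds hN)
  have h2 : (fun t => z (⌊t⌋₊ + 1) t) =ᶠ[𝓝[Ici 0] t] z N := by
    filter_upwards [self_mem_nhdsWithin, mem_nhdsWithin_of_mem_nhds (Iic_mem_nhds hN)] with s h3 h4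
    exact heq s h3 h4
  change HasDerivWithinAt _ (f (z (⌊t⌋₊ + 1) t)) _ t
  rw [heq t ht hN.le]
  exact h1.congr_of_eventuallyEq h2 (heq t ht hN.le)

/-! ### Global existence, equilibria and exponential convergence -/

namespace IsSquaredFinslerNorm

variable {E : Type*} [NormedAddCommGroup E] [NormedSpace ℝ E] {g : E × E → ℝ} {ε : ℝ}
  {f : E → E}

/-- The derivative of `g (x, f x)` along a curve whose velocity is `c • f x`. -/
theorem hasDerivWithinAt_energy (hg : IsSquaredFinslerNorm g ε) (hf : ContDiff ℝ 1 f)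
    {x : ℝ → E} {s : Set ℝ} {t c : ℝ} (hx : HasDerivWithinAt x (c • f (x t)) s t) :
    HasDerivWithinAt (fun t => g (x t, f (x t))) (c * finslerVariation f g (x t) (f (x t))) s t := by
  have h1 := ((hf.differentiable (by simp)) (x t)).hasFDerivAt.comp_hasDerivWithinAt t hx
  have h2 := HasFDerivAt.comp_hasDerivWithinAt (f := fun t => (x t, f (x t))) t
    ((hg.contDiff.differentiable (by simp)) (x t, f (x t))).hasFDerivAt (hx.prodMk h1)
  rw [_root_.map_smul, ← Prod.smul_mk, _root_.map_smul] at h2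
  exact h2

/-- The speed of a trajectory does not grow if the variation of the metric is nonpositive, so there
is no escape in finite time. -/
theorem exists_forwardSolution [FiniteDimensional ℝ E] (hg : IsSquaredFinslerNorm g ε)
    (hf : ContDiff ℝ 1 f) (hv : ∀ x v, finslerVariation f g x v ≤ 0) (p : E) :
    ∃ x : ℝ → E, IsForwardSolution f x ∧ x 0 = p := by
  have : ProperSpace E := FiniteDimensional.proper_real E
  have hsε : 0 < √ε := Real.sqrt_pos.2 hg.eps_pos
  refine IsForwardSolution.exists_of_forall_Icc hf fun T hT => ?_
  set K := √(g (p, f p)) / √ε with hK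
  have hK0 : 0 ≤ K := by positivity
  -- A trajectory of speed at most `K` moves at most `K * T` up to time `T`, so it stays where the
  -- cutoff equals `1`.
  let χ : ContDiffBump p := ⟨K * T + 1, K * T + 2, by positivity, by linarith⟩
  set F : E → E := fun x => χ x • f x with hF
  have hFs : ContDiff ℝ 1 F := χ.contDiff.smul hf
  have hFc : HasCompactSupport F := χ.hasCompactSupport.smul_right
  obtain ⟨Λ, hΛ⟩ := hFs.lipschitzWith_of_hasCompactSupport hFc one_ne_zero
  obtain ⟨B, hB⟩ := hFc.exists_bound_of_continuous hFs.continuous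
  set B' : NNReal := ⟨max B 0, le_max_right _ _⟩
  -- The truncated field is bounded and globally Lipschitz, so Picard–Lindelöf covers `[0, T]` at
  -- once.
  have hPL : IsPicardLindelof (fun _ => F) (tmin := 0) (tmax := T) ⟨0, le_rfl, hT⟩ p
      (B' * ⟨T, hT⟩) 0 B' Λ :=
    { lipschitzOnWith := fun _ _ => hΛ.lipschitzOnWith
      continuousOn := fun _ _ => continuousOn_const
      norm_le := fun _ _ x _ => (hB x).trans (le_max_left _ _)
      mul_max_le := by
        simp only [sub_zero, sub_self, max_eq_left hT, NNReal.coe_zero]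
        exact le_rfl }
  obtain ⟨x, hx0, hx⟩ := hPL.exists_eq_forall_mem_Icc_hasDerivWithinAt₀
  simp only at hx0
  refine ⟨x, hx0, fun t ht => ?_⟩
  -- The cutoff only rescales the velocity by a nonnegative factor, so the energy of the original
  -- field still decreases.
  have hV : AntitoneOn (fun t => g (x t, f (x t))) (Icc 0 T) := by
    have hd := fun t ht => hg.hasDerivWithinAt_energy hf (hx t ht)
    refine antitoneOn_of_hasDerivWithinAt_nonpos (convex_Icc 0 T)
      (fun t ht => (hd t ht).continuousWithinAt)
      (fun t ht => (hd t (interior_subset ht)).mono interior_subset) fun t _ => ?_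
    exact mul_nonpos_of_nonneg_of_nonpos χ.nonneg (hv _ _)
  have hfK : ∀ t ∈ Icc (0 : ℝ) T, ‖F (x t)‖ ≤ K := fun t ht => by
    have h1 : ‖F (x t)‖ ≤ ‖f (x t)‖ := by
      rw [hF, norm_smul, Real.norm_of_nonneg χ.nonneg]
      exact mul_le_of_le_one_left (norm_nonneg _) χ.le_one
    have h2 := hV ⟨le_rfl, hT⟩ ht ht.1
    simp only [hx0] at h2
    refine h1.trans ?_
    rw [hK, le_div_iff₀ hsε, mul_comm]
    exact (hg.sqrt_mul_norm_le _ _).trans (Real.sqrt_le_sqrt h2)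
  have h3 := norm_image_sub_le_of_norm_deriv_le_segment' hx
    (fun t ht => hfK t (Ico_subset_Icc_self ht)) t ht
  rw [hx0, sub_zero] at h3
  have h4 : χ (x t) = 1 := χ.one_of_mem_closedBall (by
    rw [mem_closedBall_iff_norm]
    have : K * t ≤ K * T := mul_le_mul_of_nonneg_left ht.2 hK0
    change _ ≤ K * T + 1
    linarith)
  have h5 := hx t ht
  simp only [hF, h4, one_smul] at h5
  exact h5

/-- On a ball `g (x, v) ≤ m ‖v‖²`, which gives the rate `δ / m`; it may degenerate as the radius
grows. -/
theorem exists_pos_rate [ProperSpace E] (hg : IsSquaredFinslerNorm g ε) {δ : ℝ} (hδ : 0 < δ)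
    (hv : ∀ x v, finslerVariation f g x v ≤ -(δ * ‖v‖ ^ 2)) (ρ : ℝ) :
    ∃ β : ℝ, 0 < β ∧ ∀ x, ‖x‖ ≤ ρ → ∀ v, finslerVariation f g x v ≤ -β * g (x, v) := by
  obtain ⟨m, hm, h⟩ := hg.exists_le_mul_norm_sq ρ
  refine ⟨δ / m, by positivity, fun x hx v => (hv x v).trans ?_⟩
  rw [neg_mul, neg_le_neg_iff, div_mul_eq_mul_div, div_le_iff₀ hm, mul_assoc, mul_comm _ m]
  exact mul_le_mul_of_nonneg_left (h x hx v) hδ.le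

/-- On the ball containing the trajectory, `g (c, f c)` decays exponentially, so `f` vanishes at any
limit point of `c`. -/
theorem exists_zero_of_bounded [ProperSpace E] (hg : IsSquaredFinslerNorm g ε)
    (hf : ContDiff ℝ 1 f) {δ : ℝ} (hδ : 0 < δ)
    (hv : ∀ x v, finslerVariation f g x v ≤ -(δ * ‖v‖ ^ 2)) {c : ℝ → E}
    (hc : IsForwardSolution f c) (hb : Bornology.IsBounded (c '' Ici 0)) : ∃ p, f p = 0 := by
  obtain ⟨ρ, hρ⟩ := hb.exists_norm_le
  have hρ' : ∀ t, 0 ≤ t → ‖c t‖ ≤ ρ := fun t ht => hρ _ (mem_image_of_mem c ht)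
  obtain ⟨β, hβ, hr⟩ := hg.exists_pos_rate hδ hv ρ
  have hd : ∀ t ∈ Ici (0 : ℝ), HasDerivWithinAt (fun t => Real.exp (β * t) * g (c t, f (c t)))
      (Real.exp (β * t) * β * g (c t, f (c t)) +
        Real.exp (β * t) * (1 * finslerVariation f g (c t) (f (c t)))) (Ici 0) t := fun t ht => by
    have h1 : HasDerivAt (fun t => Real.exp (β * t)) (Real.exp (β * t) * β) t := by
      simpa using ((hasDerivAt_id t).const_mul β).exp
    exact h1.hasDerivWithinAt.mul
      (hg.hasDerivWithinAt_energy hf (c := 1) (by rw [one_smul]; exact hc t ht))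
  have hV : AntitoneOn (fun t => Real.exp (β * t) * g (c t, f (c t))) (Ici 0) := by
    refine antitoneOn_of_hasDerivWithinAt_nonpos (convex_Ici 0)
      (fun t ht => (hd t ht).continuousWithinAt)
      (fun t ht => (hd t (interior_subset ht)).mono interior_subset) fun t ht => ?_
    have h1 := hr (c t) (hρ' t (interior_subset ht)) (f (c t))
    have h2 := mul_le_mul_of_nonneg_left h1 (Real.exp_nonneg (β * t))
    linarith
  have hle : ∀ t, 0 ≤ t → ε * ‖f (c t)‖ ^ 2 ≤ Real.exp (-(β * t)) * g (c 0, f (c 0)) :=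
    fun t ht => by
      have h1 := hV (le_refl (0 : ℝ)) ht ht
      simp only [mul_zero, Real.exp_zero, one_mul] at h1
      refine (hg.coercive (c t) _).trans ?_
      rw [Real.exp_neg, inv_mul_eq_div, le_div_iff₀ (Real.exp_pos _), mul_comm]
      exact h1
  obtain ⟨p, -, φ, hφ, hlim⟩ := (isCompact_closedBall (0 : E) ρ).tendsto_subseq
    (x := fun n : ℕ => c n) fun n => by simpa using hρ' n n.cast_nonneg
  refine ⟨p, ?_⟩
  have hlim1 : Tendsto (fun n => ε * ‖f (c (φ n : ℕ))‖ ^ 2) atTop (𝓝 (ε * ‖f p‖ ^ 2)) :=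
    ((((hf.continuous.tendsto p).comp hlim).norm.pow 2).const_mul ε)
  have hlim2 : Tendsto (fun n : ℕ => Real.exp (-(β * (φ n : ℕ))) * g (c 0, f (c 0))) atTop
      (𝓝 (0 * g (c 0, f (c 0)))) := by
    refine Tendsto.mul_const _ (Real.tendsto_exp_neg_atTop_nhds_zero.comp ?_)
    exact (tendsto_natCast_atTop_atTop.comp hφ.tendsto_atTop).const_mul_atTop hβ
  have h1 := le_of_tendsto_of_tendsto' hlim1 hlim2 fun n => hle _ (Nat.cast_nonneg _)
  rw [zero_mul] at h1
  have h2 : ‖f p‖ ^ 2 ≤ 0 := nonpos_of_mul_nonpos_right h1 hg.eps_pos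
  exact norm_eq_zero.1 (pow_eq_zero_iff two_ne_zero |>.1 (le_antisymm h2 (sq_nonneg _)))

theorem dist_le_exp_mul_dist_of_forall [ProperSpace E] (hg : IsSquaredFinslerNorm g ε)
    (hf : ContDiff ℝ 3 f) {β : ℝ} (hβ : ∀ x v, finslerVariation f g x v ≤ -β * g (x, v))
    {x y : ℝ → E} (hx : IsForwardSolution f x) (hy : IsForwardSolution f y) {T : ℝ}
    (hT : 0 ≤ T) :
    finslerDist g (x T) (y T) ≤ Real.exp (-(β / 2 * T)) * finslerDist g (x 0) (y 0) := by
  obtain ⟨a, ha⟩ := hx.exists_bound T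
  obtain ⟨b, hb⟩ := hy.exists_bound T
  obtain ⟨m, hm, h⟩ := hg.exists_dist_le_mul_norm_sub (max a b)
  refine hg.dist_le_exp_mul_dist hf hx hy hT (ρ := a + (m * (a + b) + 1) / √ε) (fun t ht => ?_)
    fun x _ => hβ x
  have h1 := h (x t) (y t) ((ha t ht).trans (le_max_left _ _)) ((hb t ht).trans (le_max_right _ _))
  have h2 : ‖x t - y t‖ ≤ a + b := (norm_sub_le _ _).trans (add_le_add (ha t ht) (hb t ht))
  gcongr
  · exact ha t ht
  · exact h1.trans (by gcongr)

theorem dist_antitoneOn [ProperSpace E] (hg : IsSquaredFinslerNorm g ε)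
    (hf : ContDiff ℝ 3 f) (hv : ∀ x v, finslerVariation f g x v ≤ 0)
    {x y : ℝ → E} (hx : IsForwardSolution f x) (hy : IsForwardSolution f y) :
    AntitoneOn (fun t => finslerDist g (x t) (y t)) (Ici 0) := by
  intro s hs t _ hst
  have := hg.dist_le_exp_mul_dist_of_forall hf (β := 0) (by simpa using hv) (hx.shift hs)
    (hy.shift hs) (sub_nonneg.2 hst)
  simpa using this

/-- Uniform exponential contraction of the trajectories that remain in a given ball. -/
theorem exists_rate_of_norm_le [ProperSpace E] (hg : IsSquaredFinslerNorm g ε)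
    (hf : ContDiff ℝ 3 f) {δ : ℝ} (hδ : 0 < δ)
    (hv : ∀ x v, finslerVariation f g x v ≤ -(δ * ‖v‖ ^ 2)) (ρ : ℝ) :
    ∃ b : ℝ, 0 < b ∧ ∀ x y : ℝ → E, IsForwardSolution f x → IsForwardSolution f y →
      (∀ t, 0 ≤ t → ‖x t‖ ≤ ρ) → (∀ t, 0 ≤ t → ‖y t‖ ≤ ρ) → ∀ t, 0 ≤ t →
        finslerDist g (x t) (y t) ≤ Real.exp (-(b * t)) * finslerDist g (x 0) (y 0) := by
  obtain ⟨m, hm, h⟩ := hg.exists_dist_le_mul_norm_sub ρ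
  obtain ⟨β, hβ, hr⟩ := hg.exists_pos_rate hδ hv (ρ + (m * (ρ + ρ) + 1) / √ε)
  -- The rate is taken on a larger ball that also contains all nearly minimal paths between points
  -- of norm at most `ρ`.
  refine ⟨β / 2, by positivity, fun x y hx hy hxb hyb t ht => ?_⟩
  refine hg.dist_le_exp_mul_dist hf hx hy ht (fun s hs => ?_) hr
  have h1 := h (x s) (y s) (hxb s hs.1) (hyb s hs.1)
  have h2 : ‖x s - y s‖ ≤ ρ + ρ := (norm_sub_le _ _).trans (add_le_add (hxb s hs.1) (hyb s hs.1))
  gcongr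
  · exact hxb s hs.1
  · exact h1.trans (by gcongr)

/-- Two equilibria keep a constant distance, which is also multiplied by a factor below `1`. -/
theorem eq_of_zero [ProperSpace E] (hg : IsSquaredFinslerNorm g ε)
    (hf : ContDiff ℝ 3 f) {δ : ℝ} (hδ : 0 < δ)
    (hv : ∀ x v, finslerVariation f g x v ≤ -(δ * ‖v‖ ^ 2)) {p q : E} (hp : f p = 0)
    (hq : f q = 0) : p = q := by
  obtain ⟨b, hb, h⟩ := hg.exists_rate_of_norm_le hf hδ hv (max ‖p‖ ‖q‖)
  have h1 := h _ _ (.const hp) (.const hq) (fun _ _ => le_max_left _ _)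
    (fun _ _ => le_max_right _ _) 1 zero_le_one
  have h2 : Real.exp (-(b * 1)) < 1 := by simpa using hb
  have h3 : finslerDist g p q ≤ 0 := by nlinarith
  have h4 := (hg.norm_sub_le_dist p q).trans h3
  have h5 := nonpos_of_mul_nonpos_right h4 (Real.sqrt_pos.2 hg.eps_pos)
  exact sub_eq_zero.1 (norm_eq_zero.1 (le_antisymm h5 (norm_nonneg _)))

/-- Two rates are used: one depending on `r` brings all trajectories into the unit metric ball
around `p` by a common time `T`; the rate `lam` of that ball is independent of `r`. -/
theorem exists_exponential_rate [ProperSpace E] (hg : IsSquaredFinslerNorm g ε)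
    (hf : ContDiff ℝ 3 f) {δ : ℝ} (hδ : 0 < δ)
    (hv : ∀ x v, finslerVariation f g x v ≤ -(δ * ‖v‖ ^ 2)) {p : E} (hp : f p = 0) :
    ∃ lam : ℝ, 0 < lam ∧ ∀ r : ℝ, ∃ C : ℝ, ∀ x y : ℝ → E,
      IsForwardSolution f x → IsForwardSolution f y → ‖x 0‖ ≤ r → ‖y 0‖ ≤ r →
        ∀ t : ℝ, 0 ≤ t → ‖x t - y t‖ ≤ C * Real.exp (-(lam * t)) * ‖x 0 - y 0‖ := by
  have hsε : 0 < √ε := Real.sqrt_pos.2 hg.eps_pos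
  have hv0 : ∀ x v, finslerVariation f g x v ≤ 0 := fun x v =>
    (hv x v).trans (neg_nonpos.2 (by positivity))
  have hball : ∀ {z : E} {D : ℝ}, finslerDist g p z ≤ D → ‖z‖ ≤ ‖p‖ + D / √ε := by
    intro z D hz
    have h1 : ‖p - z‖ ≤ D / √ε := by
      rw [le_div_iff₀ hsε, mul_comm]
      exact (hg.norm_sub_le_dist p z).trans hz
    rw [norm_sub_rev] at h1
    have h2 : ‖z‖ ≤ ‖p‖ + ‖z - p‖ := norm_le_norm_add_norm_sub' _ _
    linarith
  obtain ⟨lam, hlam, hrate⟩ := hg.exists_rate_of_norm_le hf hδ hv (‖p‖ + 1 / √ε)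
  refine ⟨lam, hlam, fun r => ?_⟩
  obtain ⟨m, hm, hmb⟩ := hg.exists_dist_le_mul_norm_sub (max r ‖p‖)
  set D := m * (‖p‖ + max r 0) with hD
  have hD0 : 0 ≤ D := by positivity
  obtain ⟨b, hb, hrate'⟩ := hg.exists_rate_of_norm_le hf hδ hv (‖p‖ + D / √ε)
  obtain ⟨T, hT0, hT⟩ : ∃ T : ℝ, 0 ≤ T ∧ Real.exp (-(b * T)) * D ≤ 1 := by
    have hlim : Tendsto (fun T : ℝ => Real.exp (-(b * T)) * D) atTop (𝓝 (0 * D)) :=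
      (Real.tendsto_exp_neg_atTop_nhds_zero.comp (tendsto_id.const_mul_atTop hb)).mul_const D
    rw [zero_mul] at hlim
    obtain ⟨T, h1, h2⟩ := ((eventually_ge_atTop 0).and (hlim.eventually_le_const one_pos)).exists
    exact ⟨T, h1, h2⟩
  have hstart : ∀ x : ℝ → E, IsForwardSolution f x → ‖x 0‖ ≤ r →
      ∀ t, 0 ≤ t → finslerDist g p (x t) ≤ D := by
    intro x hx hxr t ht
    refine (hg.dist_antitoneOn hf hv0 (.const hp) hx (le_refl (0 : ℝ)) ht ht).trans ?_
    refine (hmb p (x 0) (le_max_right _ _) (hxr.trans (le_max_left _ _))).trans ?_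
    rw [hD]
    gcongr
    exact (norm_sub_le _ _).trans (by gcongr; exact hxr.trans (le_max_left _ _))
  have henter : ∀ x : ℝ → E, IsForwardSolution f x → ‖x 0‖ ≤ r →
      ∀ t, 0 ≤ t → ‖x (T + t)‖ ≤ ‖p‖ + 1 / √ε := by
    intro x hx hxr t ht
    refine hball ?_
    have hTt : 0 ≤ T + t := add_nonneg hT0 ht
    refine (hg.dist_antitoneOn hf hv0 (.const hp) hx hT0 hTt (by linarith)).trans ?_
    refine (hrate' _ x (.const hp) hx (fun _ _ => ?_)
      (fun s hs => hball (hstart x hx hxr s hs)) T hT0).trans ?_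
    · have : 0 ≤ D / √ε := by positivity
      linarith
    · exact (mul_le_mul_of_nonneg_left (hstart x hx hxr 0 le_rfl) (Real.exp_nonneg _)).trans hT
  -- `e^{lam T}` pays for the time before `T`, when only monotonicity is used; `m` and `√ε` compare
  -- the metric distance with the norm.
  refine ⟨Real.exp (lam * T) * m / √ε, fun x y hx hy hxr hyr t ht => ?_⟩
  have hmono := hg.dist_antitoneOn hf hv0 hx hy
  have hdist : finslerDist g (x t) (y t) ≤
      Real.exp (lam * T) * Real.exp (-(lam * t)) * finslerDist g (x 0) (y 0) := by
    rw [← Real.exp_add]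
    rcases le_total t T with h | h
    · refine (hmono (le_refl (0 : ℝ)) ht ht).trans (le_mul_of_one_le_left (dist_nonneg _ _ _) ?_)
      apply Real.one_le_exp
      nlinarith
    · have h1 := hrate _ _ (hx.shift hT0) (hy.shift hT0) (henter x hx hxr) (henter y hy hyr)
        (t - T) (sub_nonneg.2 h)
      simp only [add_sub_cancel, add_zero] at h1
      have h2 : -(lam * (t - T)) = lam * T + -(lam * t) := by ring
      rw [h2] at h1
      exact h1.trans (mul_le_mul_of_nonneg_left (hmono (le_refl (0 : ℝ)) hT0 hT0)
        (Real.exp_nonneg _))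
  have hinit := hmb (x 0) (y 0) (hxr.trans (le_max_left _ _)) (hyr.trans (le_max_left _ _))
  have hfin := (hg.norm_sub_le_dist (x t) (y t)).trans (hdist.trans
    (mul_le_mul_of_nonneg_left hinit (by positivity)))
  rw [mul_comm, ← le_div_iff₀ hsε] at hfin
  exact hfin.trans (le_of_eq (by ring))

end IsSquaredFinslerNorm

/-! ### Polynomial calculus and SOS certificates -/

section PolynomialCalculus

variable {n m : ℕ}

theorem contDiff_eval_mvPolynomial {N : WithTop ℕ∞} (p : MvPolynomial (Fin n) ℝ) :
    ContDiff ℝ N fun x : StateSpace n => MvPolynomial.eval (fun k => x k) p := by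
  induction p using MvPolynomial.induction_on with
  | C a => simpa using contDiff_const
  | add p q hp hq => simpa using hp.add hq
  | mul_X p i hp =>
    have hi : ContDiff ℝ N fun x : StateSpace n => x i := by fun_prop
    simpa using hp.mul hi

theorem hasFDerivAt_eval_mvPolynomial (p : MvPolynomial (Fin n) ℝ) (x : StateSpace n) :
    HasFDerivAt (fun x : StateSpace n => MvPolynomial.eval (fun k => x k) p)
      (∑ k, MvPolynomial.eval (fun k => x k) (MvPolynomial.pderiv k p) •
        (EuclideanSpace.proj k : StateSpace n →L[ℝ] ℝ)) x := by
  classical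
  induction p using MvPolynomial.induction_on with
  | C a => simpa using hasFDerivAt_const a x
  | add p q hp hq =>
    simp only [map_add, add_smul, Finset.sum_add_distrib]
    exact hp.add hq
  | mul_X p i hp =>
    have hi : HasFDerivAt (fun x : StateSpace n => x i)
        (EuclideanSpace.proj i : StateSpace n →L[ℝ] ℝ) x :=
      (EuclideanSpace.proj i : StateSpace n →L[ℝ] ℝ).hasFDerivAt
    have h := hp.mul hi
    simp only [map_mul, MvPolynomial.eval_X]
    refine h.congr_fderiv ?_
    ext v
    simp [Derivation.leibniz, MvPolynomial.pderiv_X, Pi.single_apply, add_mul,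
      Finset.sum_add_distrib, Finset.mul_sum, apply_ite, mul_assoc]

theorem PolyField.contDiff_toFun {N : WithTop ℕ∞} (f : PolyField n) : ContDiff ℝ N f.toFun :=
  (contDiff_piLp 2).2 fun i => contDiff_eval_mvPolynomial (f i)

theorem PolyMatrix.at_apply (S : PolyMatrix n m) (x : StateSpace n) (i j : Fin m) :
    S.at x i j = MvPolynomial.eval (fun k => x k) (S i j) := rfl

theorem PolyMatrix.at_eq_map (S : PolyMatrix n m) (x : StateSpace n) :
    S.at x = (MvPolynomial.eval fun k => x k).mapMatrix S := rfl

theorem PolyField.fderiv_toFun (f : PolyField n) (x v : StateSpace n) :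
    (fderiv ℝ f.toFun x v).ofLp = (PolyMatrix.at f.jacobian x).mulVec v.ofLp := by
  have h : HasFDerivAt f.toFun
      ((PiLp.continuousLinearEquiv 2 ℝ fun _ : Fin n => ℝ).symm.toContinuousLinearMap.comp
        (ContinuousLinearMap.pi fun i =>
          ∑ k, MvPolynomial.eval (fun k => x k) (MvPolynomial.pderiv k (f i)) •
            (EuclideanSpace.proj k : StateSpace n →L[ℝ] ℝ))) x := by
    rw [← hasFDerivWithinAt_univ, hasFDerivWithinAt_piLp]
    exact fun i => (hasFDerivAt_eval_mvPolynomial (f i) x).hasFDerivWithinAt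
  rw [h.fderiv]
  ext i
  simp [Matrix.mulVec, dotProduct, PolyMatrix.at_apply, PolyField.jacobian]

/-- The squared norm `vᵀ M(x) v` of a tangent vector `v` at `x`. -/
noncomputable def PolyMatrix.metricForm (M : PolyMatrix n n) (q : StateSpace n × StateSpace n) :
    ℝ :=
  dotProduct q.2.ofLp (Matrix.mulVec (M.at q.1) q.2.ofLp)

theorem PolyMatrix.metricForm_eq_sum (M : PolyMatrix n n) (q : StateSpace n × StateSpace n) :
    M.metricForm q =
      ∑ i, ∑ j, q.2 i * q.2 j * MvPolynomial.eval (fun k => q.1 k) (M i j) := by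
  simp only [PolyMatrix.metricForm, dotProduct, Matrix.mulVec, PolyMatrix.at_apply, Finset.mul_sum]
  exact Finset.sum_congr rfl fun i _ => Finset.sum_congr rfl fun j _ => by ring

theorem PolyMatrix.contDiff_metricForm {N : WithTop ℕ∞} (M : PolyMatrix n n) :
    ContDiff ℝ N M.metricForm := by
  rw [funext M.metricForm_eq_sum]
  refine ContDiff.sum fun i _ => ContDiff.sum fun j _ => ?_
  have h : ∀ i, ContDiff ℝ N fun q : StateSpace n × StateSpace n => q.2 i := fun i => by fun_prop
  exact ((h i).mul (h j)).mul ((contDiff_eval_mvPolynomial (M i j)).comp contDiff_fst)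

/-- Both sides are the derivative at `0` of `g` along the line `h ↦ (x + h a, v + h b)`. -/
theorem PolyMatrix.fderiv_metricForm (M : PolyMatrix n n) (x v a b : StateSpace n) :
    fderiv ℝ M.metricForm (x, v) (a, b) =
      dotProduct b.ofLp (Matrix.mulVec (M.at x) v.ofLp) +
      dotProduct v.ofLp (Matrix.mulVec (M.at x) b.ofLp) +
      dotProduct v.ofLp (Matrix.mulVec (Matrix.of fun i j => ∑ k,
        MvPolynomial.eval (fun k => x k) (MvPolynomial.pderiv k (M i j)) * a k) v.ofLp) := by
  have hx : HasDerivAt (fun h : ℝ => x + h • a) a 0 := by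
    simpa using ((hasDerivAt_id (0 : ℝ)).smul_const a).const_add x
  have hv : HasDerivAt (fun h : ℝ => v + h • b) b 0 := by
    simpa using ((hasDerivAt_id (0 : ℝ)).smul_const b).const_add v
  have hvi : ∀ i, HasDerivAt (fun h : ℝ => (v + h • b) i) (b i) 0 := fun i =>
    (EuclideanSpace.proj i : StateSpace n →L[ℝ] ℝ).hasFDerivAt.comp_hasDerivAt 0 hv
  have hp : ∀ p : MvPolynomial (Fin n) ℝ,
      HasDerivAt (fun h : ℝ => MvPolynomial.eval (fun k => (x + h • a) k) p)
        (∑ k, MvPolynomial.eval (fun k => x k) (MvPolynomial.pderiv k p) * a k) 0 := fun p => by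
    have h1 : HasFDerivAt (fun x : StateSpace n => MvPolynomial.eval (fun k => x k) p) _
        (x + (0 : ℝ) • a) := hasFDerivAt_eval_mvPolynomial p _
    refine (h1.comp_hasDerivAt (0 : ℝ) hx).congr_deriv ?_
    simp
  have hsum : HasDerivAt (fun h : ℝ => M.metricForm (x + h • a, v + h • b))
      (∑ i, ∑ j, ((b i * v j + v i * b j) * MvPolynomial.eval (fun k => x k) (M i j) +
        v i * v j * ∑ k, MvPolynomial.eval (fun k => x k) (MvPolynomial.pderiv k (M i j)) * a k))
      0 := by
    simp only [PolyMatrix.metricForm_eq_sum]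
    refine HasDerivAt.fun_sum fun i _ => HasDerivAt.fun_sum fun j _ => ?_
    refine (((hvi i).mul (hvi j)).mul (hp (M i j))).congr_deriv ?_
    simp
  have hd : HasFDerivAt M.metricForm (fderiv ℝ M.metricForm (x, v))
      ((fun h : ℝ => (x + h • a, v + h • b)) 0) := by
    simpa using ((M.contDiff_metricForm (N := 1)).differentiable (by simp) (x, v)).hasFDerivAt
  have hcomp : HasDerivAt (fun h : ℝ => M.metricForm (x + h • a, v + h • b))
      (fderiv ℝ M.metricForm (x, v) (a, b)) 0 :=
    HasFDerivAt.comp_hasDerivAt (f := fun h : ℝ => (x + h • a, v + h • b)) 0 hd (hx.prodMk hv)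
  rw [hcomp.unique hsum]
  simp only [dotProduct, Matrix.mulVec, PolyMatrix.at_apply, Matrix.of_apply, Finset.mul_sum,
    ← Finset.sum_add_distrib]
  refine Finset.sum_congr rfl fun i _ => Finset.sum_congr rfl fun j _ => ?_
  rw [Finset.sum_mul, Finset.mul_sum]
  congr 1
  · ring
  · exact Finset.sum_congr rfl fun k _ => by ring

theorem PolyField.at_metricVariation (f : PolyField n) (M : PolyMatrix n n) (x : StateSpace n) :
    PolyMatrix.at (f.metricVariation M) x =
      (PolyMatrix.at f.jacobian x).transpose * M.at x + M.at x * PolyMatrix.at f.jacobian x +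
        PolyMatrix.at (f.dotMatrix M) x := by
  rw [PolyField.metricVariation]
  simp only [PolyMatrix.at_eq_map, map_add, map_mul]
  rfl

/-- For `a = f(x)` and `b = (∂f/∂x) v` the three terms of the derivative are the three summands of
`R`. -/
theorem PolyField.finslerVariation_metricForm (f : PolyField n) (M : PolyMatrix n n)
    (x v : StateSpace n) :
    finslerVariation f.toFun M.metricForm x v =
      dotProduct v.ofLp (Matrix.mulVec (PolyMatrix.at (f.metricVariation M) x) v.ofLp) := by
  rw [finslerVariation, PolyMatrix.fderiv_metricForm, f.fderiv_toFun, f.at_metricVariation,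
    Matrix.add_mulVec, Matrix.add_mulVec, dotProduct_add, dotProduct_add, ← Matrix.mulVec_mulVec,
    ← Matrix.mulVec_mulVec, Matrix.dotProduct_mulVec v.ofLp (Matrix.transpose _),
    Matrix.vecMul_transpose]
  congr 4
  ext i j
  simp [PolyField.dotMatrix, PolyField.toFun]

theorem PolyMatrix.metricForm_smul (M : PolyMatrix n n) (x : StateSpace n) (c : ℝ)
    (v : StateSpace n) : M.metricForm (x, c • v) = c ^ 2 * M.metricForm (x, v) := by
  simp only [PolyMatrix.metricForm, WithLp.ofLp_smul, Matrix.mulVec_smul, smul_dotProduct,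
    dotProduct_smul, smul_eq_mul]
  ring

theorem PolyMatrix.eval_quadForm (S : PolyMatrix n m) (x : StateSpace n) (y : Fin m → ℝ) :
    MvPolynomial.eval (Sum.elim (fun k => x k) y) S.quadForm =
      dotProduct y (Matrix.mulVec (S.at x) y) := by
  simp only [PolyMatrix.quadForm, map_sum, map_mul, MvPolynomial.eval_X, MvPolynomial.eval_rename,
    Sum.elim_inr, Sum.elim_comp_inl, dotProduct, Matrix.mulVec, PolyMatrix.at_apply,
    Finset.mul_sum, mul_assoc]

theorem IsSumSq.eval_nonneg {σ : Type*} {p : MvPolynomial σ ℝ} (hp : IsSumSq p) (x : σ → ℝ) :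
    0 ≤ MvPolynomial.eval x p := by
  induction hp with
  | zero => simp
  | sq_add a _ ih =>
    rw [map_add, map_mul]
    exact add_nonneg (mul_self_nonneg _) ih

theorem PolyMatrix.IsSOS.posSemidef_at {S : PolyMatrix n m} (hS : S.IsSOS) (x : StateSpace n) :
    (S.at x).PosSemidef := by
  refine .of_dotProduct_mulVec_nonneg ?_ fun y => ?_
  · ext i j
    simpa [PolyMatrix.at_apply] using
      congrArg (MvPolynomial.eval fun k => x k) (hS.1.apply i j)
  · rw [star_trivial, ← PolyMatrix.eval_quadForm]
    exact hS.2.eval_nonneg _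

theorem PolyMatrix.IsStrictlySOS.exists_posSemidef {S : PolyMatrix n m} (hS : S.IsStrictlySOS) :
    ∃ ε : ℝ, 0 < ε ∧
      ∀ x : StateSpace n, (S.at x - ε • (1 : Matrix (Fin m) (Fin m) ℝ)).PosSemidef := by
  obtain ⟨ε, hε, h⟩ := hS
  refine ⟨ε, hε, fun x => ?_⟩
  have h1 := h.posSemidef_at x
  have h2 : PolyMatrix.at (S - Matrix.scalar (Fin m) (MvPolynomial.C ε)) x =
      S.at x - ε • (1 : Matrix (Fin m) (Fin m) ℝ) := by
    ext i j
    by_cases hij : i = j <;> simp [PolyMatrix.at_apply, hij]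
  rwa [h2] at h1

theorem Matrix.PosSemidef.mul_norm_sq_le {A : Matrix (Fin n) (Fin n) ℝ} {ε : ℝ}
    (h : (A - ε • (1 : Matrix (Fin n) (Fin n) ℝ)).PosSemidef) (v : StateSpace n) :
    ε * ‖v‖ ^ 2 ≤ dotProduct v.ofLp (Matrix.mulVec A v.ofLp) := by
  have h1 := h.dotProduct_mulVec_nonneg v.ofLp
  rw [star_trivial, Matrix.sub_mulVec, dotProduct_sub, Matrix.smul_mulVec, Matrix.one_mulVec,
    dotProduct_smul, smul_eq_mul] at h1
  have h2 : dotProduct v.ofLp v.ofLp = ‖v‖ ^ 2 := by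
    rw [EuclideanSpace.norm_sq_eq]
    simp [dotProduct, sq]
  rw [h2] at h1
  linarith

theorem PolyMatrix.at_neg (S : PolyMatrix n m) (x : StateSpace n) :
    PolyMatrix.at (-S) x = -S.at x := by
  simp only [PolyMatrix.at_eq_map, map_neg]

end PolynomialCalculus

/-! ### The contraction theorem -/

theorem lemma1 {n : ℕ} (f : PolyField n) (M : PolyMatrix n n)
    (hM : PolyMatrix.IsStrictlySOS M)
    (hR : PolyMatrix.IsStrictlySOS (-(PolyField.metricVariation f M))) :
    -- the whole state space is a contraction region
    IsContractionRegion f M Set.univ ∧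
    -- every initial state has exactly one trajectory, and it exists for all future times
    (∀ p : StateSpace n, ∃ x : ℝ → StateSpace n, PolyField.IsSolution f x ∧ x 0 = p) ∧
    (∀ x y : ℝ → StateSpace n, PolyField.IsSolution f x → PolyField.IsSolution f y →
      x 0 = y 0 → Set.EqOn x y (Set.Ici 0)) ∧
    -- trajectories never leave a ball of constant radius around another trajectory
    (∀ x y : ℝ → StateSpace n, PolyField.IsSolution f x → PolyField.IsSolution f y →
      AntitoneOn (fun t => PolyMatrix.metricDist M (x t) (y t)) (Set.Ici 0)) ∧
    -- explicit exponential rate, whenever the metric provides one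
    (∀ β : ℝ, 0 < β →
      (∀ z : StateSpace n, (-(PolyMatrix.at (PolyField.metricVariation f M) z)
        - β • PolyMatrix.at M z).PosSemidef) →
      ∀ x y : ℝ → StateSpace n, PolyField.IsSolution f x → PolyField.IsSolution f y →
        ∀ t : ℝ, 0 ≤ t → PolyMatrix.metricDist M (x t) (y t) ≤
          Real.exp (-(β / 2 * t)) * PolyMatrix.metricDist M (x 0) (y 0)) ∧
    -- global exponential convergence, as soon as not every trajectory is unbounded
    ((∃ c : ℝ → StateSpace n, PolyField.IsSolution f c ∧
        Bornology.IsBounded (c '' Set.Ici 0)) →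
      (∃! p : StateSpace n, PolyField.toFun f p = 0) ∧ PolyField.ExponentiallyConvergent f) := by
  obtain ⟨ε, hε, hMε⟩ := hM.exists_posSemidef
  obtain ⟨δ, hδ, hRδ⟩ := hR.exists_posSemidef
  simp only [PolyMatrix.at_neg] at hRδ
  have hg : IsSquaredFinslerNorm M.metricForm ε :=
    ⟨hε, M.contDiff_metricForm, M.metricForm_smul, fun x v => (hMε x).mul_norm_sq_le v⟩
  have hf3 : ContDiff ℝ 3 f.toFun := f.contDiff_toFun
  have hf1 : ContDiff ℝ 1 f.toFun := f.contDiff_toFun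
  have hv : ∀ x v, finslerVariation f.toFun M.metricForm x v ≤ -(δ * ‖v‖ ^ 2) := fun x v => by
    have h := (hRδ x).mul_norm_sq_le v
    rw [Matrix.neg_mulVec, dotProduct_neg] at h
    rw [f.finslerVariation_metricForm]
    linarith
  have hv0 : ∀ x v, finslerVariation f.toFun M.metricForm x v ≤ 0 := fun x v =>
    (hv x v).trans (neg_nonpos.2 (by positivity))
  refine ⟨⟨⟨ε, hε, hMε⟩, δ, hδ, fun x _ => hRδ x⟩, hg.exists_forwardSolution hf1 hv0,
    fun x y hx hy h0 => IsForwardSolution.eqOn hf1 hx hy h0,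
    fun x y hx hy => hg.dist_antitoneOn hf3 hv0 hx hy, fun β _ hβ x y hx hy t ht => ?_, ?_⟩
  · refine hg.dist_le_exp_mul_dist_of_forall hf3 (fun z v => ?_) hx hy ht
    have h := (hβ z).dotProduct_mulVec_nonneg v.ofLp
    rw [star_trivial, Matrix.sub_mulVec, Matrix.neg_mulVec, dotProduct_sub, dotProduct_neg,
      Matrix.smul_mulVec, dotProduct_smul, smul_eq_mul] at h
    rw [f.finslerVariation_metricForm, PolyMatrix.metricForm]
    linarith
  · rintro ⟨c, hc, hb⟩
    obtain ⟨p, hp⟩ := hg.exists_zero_of_bounded hf1 hδ hv hc hb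
    exact ⟨⟨p, hp, fun q hq => hg.eq_of_zero hf3 hδ hv hq hp⟩,
      hg.exists_exponential_rate hf3 hδ hv hp⟩
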